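/- Let $(\Omega,\mathcal F,\mathbb P)$ be a nonatomic probability space, $n\ge 2$, $\mathtt w\in\mathbb R$, and $$\mathcal A(\mathtt w)=\Big\{(X_1,\dots,X_n)\in L^\infty(\Omega,\mathcal F,\mathbb P)^n:\ \sum_{i=1}^n X_i=\mathtt w\ \text{a.s.}\Big\}.$$ Let $T:[0,1]\to[0,1]$ be continuous, strictly increasing, twice differentiable on $(0,1)$, with $T(0)=0$ and $T(1)=1$. Let $u_1,\dots,u_n:\mathbb R\to\mathbb R$ be twice differentiable, strictly concave and increasing. Put $$U_1(X)=\int u_1(X)\,dT\circ\mathbb P\ \text{ (Choquet integral)},\qquad U_i(X)=\int u_i(X)\,d\mathbb P\quad (2\le i\le n),$$ and fix weights $\lambda_2,\dots,\lambda_n>0$. Let $I_i=(u_i')^{-1}$, defined on the range of $u_i'$; let $I_\lambda(y)=\sum_{i=2}^n I_i(y/\lambda_i)$, defined on the set $D_\lambda$ of all $y$ with $y/\lambda_i\in u_i'(\mathbb R)$ for every $i\in\{2,\dots,n\}$; and let $$J_\lambda=I_\lambda^{-1},\qquad u_\lambda(x)=\sum_{i=2}^n\lambda_i\,u_i\big(I_i(\lambda_i^{-1}J_\lambda(x))\big),\qquad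 m_\lambda(x)=\frac{u_\lambda'(\mathtt w-x)}{u_1'(x)}\quad(x\in\mathbb R).$$ Let $\delta$ be the convex envelope on $[0,1]$ of $\tilde T(t)=1-T(1-t)$, that is, the greatest convex function $\delta:[0,1]\to\mathbb R$ with $\delta\le\tilde T$. **Theorem.** An allocation $\mathbf X=(X_1,\dots,X_n)\in\mathcal A(\mathtt w)$ attains $$\sup_{\mathbf Y\in\mathcal A(\mathtt w)}\Big[U_1(Y_1)+\sum_{i=2}^n\lambda_i\,U_i(Y_i)\Big]$$ if and only if there is a random variable $\mathtt U$ on $(\Omega,\mathcal F,\mathbb P)$, uniformly distributed on $(0,1)$, such that $$X_1=m_\lambda^{-1}\big(\delta'(\mathtt U)\big)\ \text{ a.s.}\qquad\text{and}\qquad X_i=I_i\big(\lambda_i^{-1}J_\lambda(\mathtt w-X_1)\big)\ \text{ a.s. for all } i\in\{2,\dots,n\}.$$ Here the right-hand side includes the assertion that its expressions are defined: $D_\lambda\neq\emptyset$, and $\delta'(\mathtt U)$ lies a.s. in the range of $m_\lambda$. (Both hold automatically if $u_i'(\mathbb R)=(0,\infty)$ for every $i$.) -/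

import Mathlib

open MeasureTheory Set

/-- A measure is nonatomic if every measurable set of positive measure has a measurable subset of
strictly smaller positive measure. (Mathlib's `NoAtoms` only says that points are null.) -/
def IsNonatomic {Ω : Type*} [MeasurableSpace Ω] (P : Measure Ω) : Prop :=
  ∀ A : Set Ω, MeasurableSet A → 0 < P A →
    ∃ B : Set Ω, B ⊆ A ∧ MeasurableSet B ∧ 0 < P B ∧ P B < P A

/-- A probability weighting function on `[0,1]`; differentiability is only required on `(0,1)`, so
that infinite slopes at the end points are allowed. -/
structure IsWeightingFunction (T : ℝ → ℝ) : Prop where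
  mapsTo : MapsTo T (Icc 0 1) (Icc 0 1)
  map_zero : T 0 = 0
  map_one : T 1 = 1
  strictMonoOn : StrictMonoOn T (Icc 0 1)
  continuousOn : ContinuousOn T (Icc 0 1)
  differentiableOn : DifferentiableOn ℝ T (Ioo 0 1)
  differentiableOn_deriv : DifferentiableOn ℝ (deriv T) (Ioo 0 1)

/-- A utility function: twice differentiable, strictly concave and increasing on `ℝ`. -/
structure IsUtilityFunction (u : ℝ → ℝ) : Prop where
  differentiable : Differentiable ℝ u
  differentiable_deriv : Differentiable ℝ (deriv u)
  strictConcaveOn : StrictConcaveOn ℝ univ u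
  monotone : Monotone u

noncomputable section

/-- The Choquet integral of `Y` with respect to the set function `ν`. -/
def choquetIntegral {Ω : Type*} (ν : Set Ω → ℝ) (Y : Ω → ℝ) : ℝ :=
  (∫ x in Ioi (0 : ℝ), ν {ω | x < Y ω}) + ∫ x in Iio (0 : ℝ), (ν {ω | x < Y ω} - ν univ)

/-- Rank-dependent utility: the Choquet integral of `u(X)` with respect to `T ∘ P`. -/
def rankDependentUtility {Ω : Type*} [MeasurableSpace Ω] (P : Measure Ω) (T u : ℝ → ℝ)
    (X : Ω → ℝ) : ℝ :=
  choquetIntegral (fun A => T (P.real A)) (fun ω => u (X ω))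

/-- Expected utility. -/
def expectedUtility {Ω : Type*} [MeasurableSpace Ω] (P : Measure Ω) (u : ℝ → ℝ)
    (X : Ω → ℝ) : ℝ :=
  ∫ ω, u (X ω) ∂P

/-- Feasible allocations: families of essentially bounded random variables, one for each of the
`N + 1` agents, that add up to the constant `w` almost surely. Agent `0` is the RDU agent and the
agents `i.succ`, `i : Fin N`, are the EU agents. -/
def feasibleAllocations {Ω : Type*} [MeasurableSpace Ω] (P : Measure Ω) (N : ℕ) (w : ℝ) :
    Set (Fin (N + 1) → Ω → ℝ) :=
  {X | (∀ i, MemLp (X i) ⊤ P) ∧ ∀ᵐ ω ∂P, ∑ i, X i ω = w}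

/-- The weighted utilitarian welfare of an allocation; the RDU agent has weight one. -/
def welfare {Ω : Type*} [MeasurableSpace Ω] (P : Measure Ω) (T : ℝ → ℝ) {N : ℕ}
    (u : Fin (N + 1) → ℝ → ℝ) (lam : Fin N → ℝ) (X : Fin (N + 1) → Ω → ℝ) : ℝ :=
  rankDependentUtility P T (u 0) (X 0) +
    ∑ i : Fin N, lam i * expectedUtility P (u i.succ) (X i.succ)

/-- The allocation `X` is feasible and attains the supremum of the welfare over all feasible
allocations. -/
def IsWelfareOptimal {Ω : Type*} [MeasurableSpace Ω] (P : Measure Ω) (T : ℝ → ℝ) {N : ℕ}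
    (u : Fin (N + 1) → ℝ → ℝ) (lam : Fin N → ℝ) (w : ℝ) (X : Fin (N + 1) → Ω → ℝ) : Prop :=
  X ∈ feasibleAllocations P N w ∧
    ∀ Y ∈ feasibleAllocations P N w, welfare P T u lam Y ≤ welfare P T u lam X

/-- The conjugate distortion `t ↦ 1 - T (1 - t)`. -/
def conjugateDistortion (T : ℝ → ℝ) (t : ℝ) : ℝ := 1 - T (1 - t)

/-- The convex envelope on `[0,1]`: the pointwise supremum of the convex minorants. -/
def convexEnvelope (f : ℝ → ℝ) (x : ℝ) : ℝ :=
  sSup {y | ∃ g : ℝ → ℝ, ConvexOn ℝ (Icc 0 1) g ∧ (∀ t ∈ Icc (0 : ℝ) 1, g t ≤ f t) ∧ y = g x}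

/-- `I = (u')⁻¹`, meaningful on the range of `u'`. -/
def inverseMarginal (u : ℝ → ℝ) : ℝ → ℝ := Function.invFun (deriv u)

/-- The points `y` at which `I_i (y / λ_i)` is defined for every EU agent `i`. -/
def aggregateDomain {N : ℕ} (v : Fin N → ℝ → ℝ) (lam : Fin N → ℝ) : Set ℝ :=
  {y | ∀ i, y / lam i ∈ range (deriv (v i))}

/-- `I_λ (y) = ∑ i, I_i (y / λ_i)`, meaningful on `aggregateDomain`. -/
def aggregateInverse {N : ℕ} (v : Fin N → ℝ → ℝ) (lam : Fin N → ℝ) (y : ℝ) : ℝ :=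
  ∑ i, inverseMarginal (v i) (y / lam i)

/-- `J_λ = (I_λ)⁻¹`, the inverse of `I_λ` on its domain. -/
def aggregateMarginal {N : ℕ} (v : Fin N → ℝ → ℝ) (lam : Fin N → ℝ) : ℝ → ℝ :=
  Function.invFunOn (aggregateInverse v lam) (aggregateDomain v lam)

/-- The aggregate utility `u_λ (x) = ∑ i, λ_i u_i (I_i (J_λ (x) / λ_i))` of the EU agents. -/
def aggregateUtility {N : ℕ} (v : Fin N → ℝ → ℝ) (lam : Fin N → ℝ) (x : ℝ) : ℝ :=
  ∑ i, lam i * v i (inverseMarginal (v i) (aggregateMarginal v lam x / lam i))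

/-- `m_λ (x) = u_λ' (w - x) / u_1' (x)`. -/
def marginalRatio {N : ℕ} (u₁ : ℝ → ℝ) (v : Fin N → ℝ → ℝ) (lam : Fin N → ℝ) (w x : ℝ) : ℝ :=
  deriv (aggregateUtility v lam) (w - x) / deriv u₁ x

end

/-! The EU agents behave as one representative agent with utility `u_λ`. If all weighted marginal
utilities agree at a common price `y`, tangent lines show that no other sharing of the same total
does better. The optimal price is `J_λ`, and it is the derivative of `u_λ`. Conversely, at an
optimum a profitable bilateral transfer on a set of positive measure is impossible, so the prices
agree a.s.; this makes `D_λ` nonempty and forces the shares. What remains is the choice of `X_1`.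

The Choquet integral is linearized by a change of measure. On a nonatomic space every `Y` is
comonotone with some uniform `U`: a maximal chain of events through the level sets of `Y` takes all
probabilities and so indexes such a `U`. An upper level set of `Y` is then a.s. `{U > s}`, with
weight `T(1 - s) = 1 - T̃(s) ≤ 1 - δ(s)`, and the right side is its mass under the density `δ'(U)`.
Hence `U_1(Y)` is at most the expectation of `δ'(U) u_1(Y)`. Equality holds if `Y` is also a
function of `δ'(U)`, because `δ` is affine wherever `δ < T̃`, so no level set can have its threshold
there (`choquetIntegral_le_of_aeComonotone`, `choquetIntegral_eq_of_aeComonotone`).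

The welfare is thus bounded by the expectation of `s u_1(q) + u_λ(w - q)` with `s = δ'(U)`, `q =
Y_1`. This integrand is strictly concave in `q` for `s ≥ 0`, with first order condition `m_λ(q) =
s`. Its pointwise maximizer is monotone in `s`, so the bound is attained there, and strictness gives
uniqueness. The bound depends on `U` only through its law, so competitors with different uniform
variables can be compared. -/

open Filter Topology

/-! ### Utility functions -/

namespace IsUtilityFunction

variable {u : ℝ → ℝ}

theorem continuous_deriv (h : IsUtilityFunction u) : Continuous (deriv u) :=
  h.differentiable_deriv.continuous

theorem strictAnti_deriv (h : IsUtilityFunction u) : StrictAnti (deriv u) :=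
  strictAntiOn_univ.1 (h.strictConcaveOn.strictAntiOn_deriv fun x _ => h.differentiable x)

/-- Monotonicity only gives `u' ≥ 0`; positivity follows from `u'(x) > u'(x + 1) ≥ 0`. -/
theorem deriv_pos (h : IsUtilityFunction u) (x : ℝ) : 0 < deriv u x :=
  h.monotone.deriv_nonneg.trans_lt (h.strictAnti_deriv (lt_add_one x))

/-- A strictly concave function lies strictly below its tangents. -/
theorem lt_tangent (h : IsUtilityFunction u) {a x : ℝ} (hx : x ≠ a) :
    u x < u a + deriv u a * (x - a) := by
  rcases hx.lt_or_gt with hlt | hlt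
  · have := h.strictConcaveOn.deriv_lt_slope (mem_univ x) (mem_univ a) hlt (h.differentiable a)
    rw [slope_def_field, lt_div_iff₀ (by linarith)] at this
    linarith
  · have := h.strictConcaveOn.slope_lt_deriv (mem_univ a) (mem_univ x) hlt (h.differentiable a)
    rw [slope_def_field, div_lt_iff₀ (by linarith)] at this
    linarith

theorem le_tangent (h : IsUtilityFunction u) (a x : ℝ) :
    u x ≤ u a + deriv u a * (x - a) := by
  rcases eq_or_ne x a with rfl | hx
  · simp
  · exact (h.lt_tangent hx).le

theorem inverseMarginal_deriv (h : IsUtilityFunction u) (x : ℝ) :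
    inverseMarginal u (deriv u x) = x :=
  Function.leftInverse_invFun h.strictAnti_deriv.injective x

theorem deriv_inverseMarginal {y : ℝ} (hy : y ∈ range (deriv u)) :
    deriv u (inverseMarginal u y) = y :=
  Function.invFun_eq hy

/-- A strictly monotone map whose range is an interval is an embedding. Continuity of `I` is thus
obtained even where `u''` vanishes. -/
theorem isEmbedding_deriv (h : IsUtilityFunction u) : IsEmbedding (deriv u) := by
  have hc : Continuous fun x => -deriv u x := h.continuous_deriv.neg
  have h1 : IsEmbedding fun x => -deriv u x :=
    (show StrictMono fun x => -deriv u x from h.strictAnti_deriv.neg).isEmbedding_of_ordConnected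
      (isPreconnected_range hc).ordConnected
  have h2 := (Homeomorph.neg ℝ).isEmbedding.comp h1
  convert h2 using 1
  ext x
  simp

/-- Continuity of a composition with the inverse of the marginal utility. -/
theorem continuousOn_inverseMarginal_comp (h : IsUtilityFunction u) {g : ℝ → ℝ} {s : Set ℝ}
    (hg : ContinuousOn g s) (hs : ∀ x ∈ s, g x ∈ range (deriv u)) :
    ContinuousOn (fun x => inverseMarginal u (g x)) s := by
  rw [h.isEmbedding_deriv.continuousOn_iff]
  exact hg.congr fun x hx => deriv_inverseMarginal (hs x hx)

end IsUtilityFunction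

/-- A function squeezed between two functions with the same value and the same derivative at a
point has this derivative there. -/
theorem HasDerivAt.of_le_of_le {f g h : ℝ → ℝ} {a c : ℝ} (hf : HasDerivAt f c a)
    (hh : HasDerivAt h c a) (hfg : ∀ᶠ x in 𝓝 a, f x ≤ g x) (hgh : ∀ᶠ x in 𝓝 a, g x ≤ h x)
    (hfa : f a = g a) (hha : g a = h a) : HasDerivAt g c a := by
  rw [hasDerivAt_iff_isLittleO] at *
  refine Asymptotics.IsBigO.trans_isLittleO (Asymptotics.IsBigO.of_bound 1 ?_)
    (hf.norm_left.add hh.norm_left)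
  filter_upwards [hfg, hgh] with x h1 h2
  simp only [Real.norm_eq_abs, smul_eq_mul, one_mul]
  rw [abs_of_nonneg (add_nonneg (abs_nonneg (f x - f a - (x - a) * c))
    (abs_nonneg (h x - h a - (x - a) * c))), abs_le]
  constructor
  · have := neg_abs_le (f x - f a - (x - a) * c)
    have := abs_nonneg (h x - h a - (x - a) * c)
    linarith
  · have := le_abs_self (h x - h a - (x - a) * c)
    have := abs_nonneg (f x - f a - (x - a) * c)
    linarith

/-! ### The representative agent of the EU agents -/

section Aggregate

variable {N : ℕ} {v : Fin N → ℝ → ℝ} {lam : Fin N → ℝ}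

theorem mul_deriv_inverseMarginal (hlam : ∀ i, 0 < lam i) {y : ℝ}
    (hy : y ∈ aggregateDomain v lam) (i : Fin N) :
    lam i * deriv (v i) (inverseMarginal (v i) (y / lam i)) = y := by
  rw [IsUtilityFunction.deriv_inverseMarginal (hy i)]
  field_simp [(hlam i).ne']

theorem inverseMarginal_div_eq (hv : ∀ i, IsUtilityFunction (v i)) (hlam : ∀ i, 0 < lam i)
    {y x : ℝ} {i : Fin N} (h : lam i * deriv (v i) x = y) :
    inverseMarginal (v i) (y / lam i) = x := by
  rw [← h, mul_div_cancel_left₀ _ (hlam i).ne', (hv i).inverseMarginal_deriv]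

theorem mem_aggregateDomain (hlam : ∀ i, 0 < lam i) {y : ℝ} {x : Fin N → ℝ}
    (h : ∀ i, lam i * deriv (v i) (x i) = y) : y ∈ aggregateDomain v lam := fun i =>
  ⟨x i, by rw [← h i, mul_div_cancel_left₀ _ (hlam i).ne']⟩

theorem inverseMarginal_lt (hv : ∀ i, IsUtilityFunction (v i)) (hlam : ∀ i, 0 < lam i)
    {y z : ℝ} (hy : y ∈ aggregateDomain v lam) (hz : z ∈ aggregateDomain v lam) (hyz : y < z)
    (i : Fin N) :
    inverseMarginal (v i) (z / lam i) < inverseMarginal (v i) (y / lam i) := by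
  rw [← (hv i).strictAnti_deriv.lt_iff_gt, IsUtilityFunction.deriv_inverseMarginal (hy i),
    IsUtilityFunction.deriv_inverseMarginal (hz i)]
  exact div_lt_div_of_pos_right hyz (hlam i)

theorem strictAntiOn_aggregateInverse [NeZero N] (hv : ∀ i, IsUtilityFunction (v i))
    (hlam : ∀ i, 0 < lam i) :
    StrictAntiOn (aggregateInverse v lam) (aggregateDomain v lam) := fun _ hy _ hz hyz =>
  Finset.sum_lt_sum_of_nonempty ⟨0, Finset.mem_univ _⟩ fun i _ =>
    inverseMarginal_lt hv hlam hy hz hyz i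

theorem ordConnected_aggregateDomain (hv : ∀ i, IsUtilityFunction (v i))
    (hlam : ∀ i, 0 < lam i) : OrdConnected (aggregateDomain v lam) := by
  refine ⟨fun y hy z hz t ht i => ?_⟩
  exact (isPreconnected_range (hv i).continuous_deriv).ordConnected.out (hy i) (hz i)
    ⟨div_le_div_of_nonneg_right ht.1 (hlam i).le, div_le_div_of_nonneg_right ht.2 (hlam i).le⟩

theorem continuousOn_aggregateInverse (hv : ∀ i, IsUtilityFunction (v i)) :
    ContinuousOn (aggregateInverse v lam) (aggregateDomain v lam) :=
  continuousOn_finsetSum _ fun i _ => (hv i).continuousOn_inverseMarginal_comp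
    (continuous_id.div_const _).continuousOn fun _ hy => hy i

/-- The domain may be a bounded interval, so a price cannot simply be sent to an end point. Starting
from the shares `a i` at a known price, let every agent gain `d` and take the largest resulting
weighted marginal utility as the new price. Each agent reaches it between `a i` and `a i + d`, and
the maximizing agent `j` gains the full `d`. -/
theorem exists_le_aggregateInverse [NeZero N] (hv : ∀ i, IsUtilityFunction (v i))
    (hlam : ∀ i, 0 < lam i) (hD : (aggregateDomain v lam).Nonempty) (x : ℝ) :
    ∃ y ∈ aggregateDomain v lam, x ≤ aggregateInverse v lam y := by
  obtain ⟨y₀, hy₀⟩ := hD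
  set a : Fin N → ℝ := fun i => inverseMarginal (v i) (y₀ / lam i) with ha
  have hga : ∀ i, lam i * deriv (v i) (a i) = y₀ := mul_deriv_inverseMarginal hlam hy₀
  set d : ℝ := |x - ∑ i, a i| with hd
  obtain ⟨j, hj⟩ := Finite.exists_max fun i => lam i * deriv (v i) (a i + d)
  have hle : ∀ i, lam i * deriv (v i) (a i + d) ≤ y₀ := fun i => by
    rw [← hga i]
    exact mul_le_mul_of_nonneg_left
      ((hv i).strictAnti_deriv.antitone (by linarith [abs_nonneg (x - ∑ i, a i)])) (hlam i).le
  have hmem : ∀ i, ∃ b, lam i * deriv (v i) b = lam j * deriv (v j) (a j + d) := fun i =>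
    mem_range_of_exists_le_of_exists_ge ((hv i).continuous_deriv.const_mul (lam i))
      ⟨a i + d, hj i⟩ ⟨a i, by rw [hga i]; exact hle j⟩
  choose b hb using hmem
  refine ⟨_, mem_aggregateDomain hlam hb, ?_⟩
  have hsum : aggregateInverse v lam (lam j * deriv (v j) (a j + d)) = ∑ i, b i :=
    Finset.sum_congr rfl fun i _ => inverseMarginal_div_eq hv hlam (hb i)
  have hab : ∀ i, a i ≤ b i := fun i => by
    rw [← (hv i).strictAnti_deriv.le_iff_ge]
    refine le_of_mul_le_mul_left ?_ (hlam i)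
    rw [hb i, hga i]
    exact hle j
  have hbj : b j = a j + d :=
    (hv j).strictAnti_deriv.injective (mul_left_cancel₀ (hlam j).ne' (hb j))
  have h1 : b j - a j ≤ ∑ i, (b i - a i) :=
    Finset.single_le_sum (f := fun i => b i - a i) (fun i _ => sub_nonneg.2 (hab i))
      (Finset.mem_univ j)
  rw [Finset.sum_sub_distrib] at h1
  rw [hsum]
  linarith [le_abs_self (x - ∑ i, a i)]

/-- Mirror image: every agent loses `d`, and the smallest resulting weighted marginal utility is the
new price. -/
theorem exists_aggregateInverse_le [NeZero N] (hv : ∀ i, IsUtilityFunction (v i))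
    (hlam : ∀ i, 0 < lam i) (hD : (aggregateDomain v lam).Nonempty) (x : ℝ) :
    ∃ y ∈ aggregateDomain v lam, aggregateInverse v lam y ≤ x := by
  obtain ⟨y₀, hy₀⟩ := hD
  set a : Fin N → ℝ := fun i => inverseMarginal (v i) (y₀ / lam i) with ha
  have hga : ∀ i, lam i * deriv (v i) (a i) = y₀ := mul_deriv_inverseMarginal hlam hy₀
  set d : ℝ := |x - ∑ i, a i| with hd
  obtain ⟨j, hj⟩ := Finite.exists_min fun i => lam i * deriv (v i) (a i - d)
  have hle : ∀ i, y₀ ≤ lam i * deriv (v i) (a i - d) := fun i => by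
    rw [← hga i]
    exact mul_le_mul_of_nonneg_left
      ((hv i).strictAnti_deriv.antitone (by linarith [abs_nonneg (x - ∑ i, a i)])) (hlam i).le
  have hmem : ∀ i, ∃ b, lam i * deriv (v i) b = lam j * deriv (v j) (a j - d) := fun i =>
    mem_range_of_exists_le_of_exists_ge ((hv i).continuous_deriv.const_mul (lam i))
      ⟨a i, by rw [hga i]; exact hle j⟩ ⟨a i - d, hj i⟩
  choose b hb using hmem
  refine ⟨_, mem_aggregateDomain hlam hb, ?_⟩
  have hsum : aggregateInverse v lam (lam j * deriv (v j) (a j - d)) = ∑ i, b i :=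
    Finset.sum_congr rfl fun i _ => inverseMarginal_div_eq hv hlam (hb i)
  have hab : ∀ i, b i ≤ a i := fun i => by
    rw [← (hv i).strictAnti_deriv.le_iff_ge]
    refine le_of_mul_le_mul_left ?_ (hlam i)
    rw [hb i, hga i]
    exact hle j
  have hbj : b j = a j - d :=
    (hv j).strictAnti_deriv.injective (mul_left_cancel₀ (hlam j).ne' (hb j))
  have h1 : a j - b j ≤ ∑ i, (a i - b i) :=
    Finset.single_le_sum (f := fun i => a i - b i) (fun i _ => sub_nonneg.2 (hab i))
      (Finset.mem_univ j)
  rw [Finset.sum_sub_distrib] at h1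
  rw [hsum]
  linarith [neg_abs_le (x - ∑ i, a i)]

theorem aggregateInverse_surjOn [NeZero N] (hv : ∀ i, IsUtilityFunction (v i))
    (hlam : ∀ i, 0 < lam i) (hD : (aggregateDomain v lam).Nonempty) (x : ℝ) :
    ∃ y ∈ aggregateDomain v lam, aggregateInverse v lam y = x := by
  obtain ⟨y, hy, hxy⟩ := exists_aggregateInverse_le hv hlam hD x
  obtain ⟨z, hz, hxz⟩ := exists_le_aggregateInverse hv hlam hD x
  exact (ordConnected_aggregateDomain hv hlam).isPreconnected.intermediate_value hy hz
    (continuousOn_aggregateInverse hv) ⟨hxy, hxz⟩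

theorem aggregateMarginal_mem [NeZero N] (hv : ∀ i, IsUtilityFunction (v i))
    (hlam : ∀ i, 0 < lam i) (hD : (aggregateDomain v lam).Nonempty) (x : ℝ) :
    aggregateMarginal v lam x ∈ aggregateDomain v lam :=
  Function.invFunOn_mem (aggregateInverse_surjOn hv hlam hD x)

theorem aggregateInverse_aggregateMarginal [NeZero N] (hv : ∀ i, IsUtilityFunction (v i))
    (hlam : ∀ i, 0 < lam i) (hD : (aggregateDomain v lam).Nonempty) (x : ℝ) :
    aggregateInverse v lam (aggregateMarginal v lam x) = x :=
  Function.invFunOn_eq (aggregateInverse_surjOn hv hlam hD x)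

theorem aggregateMarginal_aggregateInverse [NeZero N] (hv : ∀ i, IsUtilityFunction (v i))
    (hlam : ∀ i, 0 < lam i) {y : ℝ} (hy : y ∈ aggregateDomain v lam) :
    aggregateMarginal v lam (aggregateInverse v lam y) = y :=
  (strictAntiOn_aggregateInverse hv hlam).injOn
    (aggregateMarginal_mem hv hlam ⟨y, hy⟩ _) hy
    (aggregateInverse_aggregateMarginal hv hlam ⟨y, hy⟩ _)

theorem aggregateMarginal_pos [NeZero N] (hv : ∀ i, IsUtilityFunction (v i))
    (hlam : ∀ i, 0 < lam i) (hD : (aggregateDomain v lam).Nonempty) (x : ℝ) :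
    0 < aggregateMarginal v lam x := by
  rw [← mul_deriv_inverseMarginal hlam (aggregateMarginal_mem hv hlam hD x) 0]
  exact mul_pos (hlam 0) ((hv 0).deriv_pos _)

theorem strictAnti_aggregateMarginal [NeZero N] (hv : ∀ i, IsUtilityFunction (v i))
    (hlam : ∀ i, 0 < lam i) (hD : (aggregateDomain v lam).Nonempty) :
    StrictAnti (aggregateMarginal v lam) := fun x y hxy => by
  have := (strictAntiOn_aggregateInverse hv hlam).lt_iff_gt (aggregateMarginal_mem hv hlam hD x)
    (aggregateMarginal_mem hv hlam hD y)
  rw [aggregateInverse_aggregateMarginal hv hlam hD,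
    aggregateInverse_aggregateMarginal hv hlam hD] at this
  exact this.1 hxy

/-- A strictly monotone function whose range is an interval is continuous; here the range is all of
`D_λ`. The reflection `x ↦ -x` turns antitone into monotone. -/
theorem continuous_aggregateMarginal [NeZero N] (hv : ∀ i, IsUtilityFunction (v i))
    (hlam : ∀ i, 0 < lam i) (hD : (aggregateDomain v lam).Nonempty) :
    Continuous (aggregateMarginal v lam) := by
  have hanti := strictAnti_aggregateMarginal hv hlam hD
  have hrange : range (aggregateMarginal v lam) = aggregateDomain v lam := by
    refine Subset.antisymm (range_subset_iff.2 (aggregateMarginal_mem hv hlam hD)) fun y hy => ?_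
    exact ⟨_, aggregateMarginal_aggregateInverse hv hlam hy⟩
  have hord : OrdConnected (range fun x => aggregateMarginal v lam (-x)) := by
    rw [show (fun x => aggregateMarginal v lam (-x)) = aggregateMarginal v lam ∘ Neg.neg from rfl,
      neg_surjective.range_comp, hrange]
    exact ordConnected_aggregateDomain hv hlam
  have hmono : StrictMono fun x => aggregateMarginal v lam (-x) := fun x y hxy =>
    hanti (neg_lt_neg hxy)
  simpa [Function.comp_def] using
    (hmono.isEmbedding_of_ordConnected hord).continuous.comp continuous_neg

/-- The optimal share of the `i`-th agent when the EU agents share the amount `x`. -/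
noncomputable def optimalShare (v : Fin N → ℝ → ℝ) (lam : Fin N → ℝ) (i : Fin N) (x : ℝ) : ℝ :=
  inverseMarginal (v i) (aggregateMarginal v lam x / lam i)

theorem sum_optimalShare [NeZero N] (hv : ∀ i, IsUtilityFunction (v i))
    (hlam : ∀ i, 0 < lam i) (hD : (aggregateDomain v lam).Nonempty) (x : ℝ) :
    ∑ i, optimalShare v lam i x = x :=
  aggregateInverse_aggregateMarginal hv hlam hD x

theorem mul_deriv_optimalShare [NeZero N] (hv : ∀ i, IsUtilityFunction (v i))
    (hlam : ∀ i, 0 < lam i) (hD : (aggregateDomain v lam).Nonempty) (x : ℝ) (i : Fin N) :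
    lam i * deriv (v i) (optimalShare v lam i x) = aggregateMarginal v lam x :=
  mul_deriv_inverseMarginal hlam (aggregateMarginal_mem hv hlam hD x) i

theorem continuous_optimalShare [NeZero N] (hv : ∀ i, IsUtilityFunction (v i))
    (hlam : ∀ i, 0 < lam i) (hD : (aggregateDomain v lam).Nonempty) (i : Fin N) :
    Continuous (optimalShare v lam i) := by
  rw [← continuousOn_univ]
  exact (hv i).continuousOn_inverseMarginal_comp
    ((continuous_aggregateMarginal hv hlam hD).div_const _).continuousOn
    fun x _ => aggregateMarginal_mem hv hlam hD x i

theorem aggregateUtility_eq (x : ℝ) :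
    aggregateUtility v lam x = ∑ i, lam i * v i (optimalShare v lam i x) := rfl

/-- The aggregate utility is the value of the sharing problem, with the supporting price
`aggregateMarginal`. -/
theorem sum_le_aggregateUtility [NeZero N] (hv : ∀ i, IsUtilityFunction (v i))
    (hlam : ∀ i, 0 < lam i) (hD : (aggregateDomain v lam).Nonempty) (x : ℝ) (z : Fin N → ℝ) :
    ∑ i, lam i * v i (z i) ≤
      aggregateUtility v lam x + aggregateMarginal v lam x * (∑ i, z i - x) := by
  have h1 : ∀ i, lam i * v i (z i) ≤ lam i * v i (optimalShare v lam i x) +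
      aggregateMarginal v lam x * (z i - optimalShare v lam i x) := fun i => by
    rw [← mul_deriv_optimalShare hv hlam hD x i, mul_assoc, ← mul_add]
    exact mul_le_mul_of_nonneg_left ((hv i).le_tangent _ _) (hlam i).le
  refine (Finset.sum_le_sum fun i _ => h1 i).trans_eq ?_
  rw [Finset.sum_add_distrib, ← Finset.mul_sum, Finset.sum_sub_distrib,
    sum_optimalShare hv hlam hD, aggregateUtility_eq]

/-- Different totals have different prices, so every agent's share changes and each individual
tangent inequality is strict. -/
theorem aggregateUtility_lt_tangent [NeZero N] (hv : ∀ i, IsUtilityFunction (v i))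
    (hlam : ∀ i, 0 < lam i) (hD : (aggregateDomain v lam).Nonempty) {x y : ℝ} (hxy : y ≠ x) :
    aggregateUtility v lam y < aggregateUtility v lam x + aggregateMarginal v lam x * (y - x) := by
  have h1 : ∀ i, lam i * v i (optimalShare v lam i y) < lam i * v i (optimalShare v lam i x) +
      aggregateMarginal v lam x * (optimalShare v lam i y - optimalShare v lam i x) := fun i => by
    have hne : optimalShare v lam i y ≠ optimalShare v lam i x := fun h => by
      have h2 := mul_deriv_optimalShare hv hlam hD y i
      rw [h, mul_deriv_optimalShare hv hlam hD x i] at h2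
      exact hxy ((strictAnti_aggregateMarginal hv hlam hD).injective h2).symm
    rw [← mul_deriv_optimalShare hv hlam hD x i, mul_assoc, ← mul_add]
    exact mul_lt_mul_of_pos_left ((hv i).lt_tangent hne) (hlam i)
  refine (Finset.sum_lt_sum_of_nonempty ⟨0, Finset.mem_univ _⟩ fun i _ => h1 i).trans_eq ?_
  rw [Finset.sum_add_distrib, ← Finset.mul_sum, Finset.sum_sub_distrib,
    sum_optimalShare hv hlam hD, sum_optimalShare hv hlam hD, aggregateUtility_eq]

/-- An envelope argument that needs no derivative of `J_λ`: the aggregate utility lies below its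
supporting line and above the value of the suboptimal sharing in which agent `0` absorbs the whole
increment `y - x`. Both bounds touch it at `x` with slope `J_λ(x)`. -/
theorem hasDerivAt_aggregateUtility [NeZero N] (hv : ∀ i, IsUtilityFunction (v i))
    (hlam : ∀ i, 0 < lam i) (hD : (aggregateDomain v lam).Nonempty) (x : ℝ) :
    HasDerivAt (aggregateUtility v lam) (aggregateMarginal v lam x) x := by
  have hupper : HasDerivAt
      (fun y => aggregateUtility v lam x + aggregateMarginal v lam x * (y - x))
      (aggregateMarginal v lam x) x := by
    simpa using (((hasDerivAt_id x).sub_const x).const_mul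
      (aggregateMarginal v lam x)).const_add (aggregateUtility v lam x)
  have hlower : HasDerivAt (fun y => aggregateUtility v lam x +
      (lam 0 * v 0 (optimalShare v lam 0 x + (y - x)) - lam 0 * v 0 (optimalShare v lam 0 x)))
      (aggregateMarginal v lam x) x := by
    have h0 : HasDerivAt (v 0) (deriv (v 0) (optimalShare v lam 0 x + (x - x)))
        (optimalShare v lam 0 x + (x - x)) := ((hv 0).differentiable _).hasDerivAt
    have h1 := h0.comp x (((hasDerivAt_id x).sub_const x).const_add (optimalShare v lam 0 x))
    have h2 := ((h1.const_mul (lam 0)).sub_const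
      (lam 0 * v 0 (optimalShare v lam 0 x))).const_add (aggregateUtility v lam x)
    simpa [mul_deriv_optimalShare hv hlam hD x 0, Function.comp_def] using h2
  refine hlower.of_le_of_le hupper (Eventually.of_forall fun y => ?_)
    (Eventually.of_forall fun y => ?_) (by simp) (by simp)
  · have h1 := sum_le_aggregateUtility hv hlam hD y
      (fun i => optimalShare v lam i x + if i = 0 then y - x else 0)
    have h2 : ∑ i, (optimalShare v lam i x + if i = 0 then y - x else 0) = y := by
      simp [Finset.sum_add_distrib, sum_optimalShare hv hlam hD]
    rw [h2, sub_self, mul_zero, add_zero] at h1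
    refine le_trans (le_of_eq ?_) h1
    rw [← Finset.add_sum_erase _ _ (Finset.mem_univ (0 : Fin N)), aggregateUtility_eq,
      ← Finset.add_sum_erase _ _ (Finset.mem_univ (0 : Fin N))]
    have h3 : ∑ i ∈ Finset.univ.erase (0 : Fin N),
        lam i * v i (optimalShare v lam i x + if i = 0 then y - x else 0) =
        ∑ i ∈ Finset.univ.erase (0 : Fin N), lam i * v i (optimalShare v lam i x) :=
      Finset.sum_congr rfl fun i hi => by simp [Finset.ne_of_mem_erase hi]
    rw [h3]
    simp
    ring
  · rcases eq_or_ne y x with rfl | hne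
    · simp
    · exact (aggregateUtility_lt_tangent hv hlam hD hne).le

theorem deriv_aggregateUtility [NeZero N] (hv : ∀ i, IsUtilityFunction (v i))
    (hlam : ∀ i, 0 < lam i) (hD : (aggregateDomain v lam).Nonempty) :
    deriv (aggregateUtility v lam) = aggregateMarginal v lam :=
  funext fun x => (hasDerivAt_aggregateUtility hv hlam hD x).deriv

variable {u₁ : ℝ → ℝ} {w : ℝ}

theorem marginalRatio_eq [NeZero N] (hv : ∀ i, IsUtilityFunction (v i))
    (hlam : ∀ i, 0 < lam i) (hD : (aggregateDomain v lam).Nonempty) (x : ℝ) :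
    marginalRatio u₁ v lam w x = aggregateMarginal v lam (w - x) / deriv u₁ x := by
  rw [marginalRatio, deriv_aggregateUtility hv hlam hD]

theorem marginalRatio_pos [NeZero N] (hu : IsUtilityFunction u₁)
    (hv : ∀ i, IsUtilityFunction (v i)) (hlam : ∀ i, 0 < lam i)
    (hD : (aggregateDomain v lam).Nonempty) (x : ℝ) : 0 < marginalRatio u₁ v lam w x := by
  rw [marginalRatio_eq hv hlam hD]
  exact div_pos (aggregateMarginal_pos hv hlam hD _) (hu.deriv_pos x)

theorem strictMono_marginalRatio [NeZero N] (hu : IsUtilityFunction u₁)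
    (hv : ∀ i, IsUtilityFunction (v i)) (hlam : ∀ i, 0 < lam i)
    (hD : (aggregateDomain v lam).Nonempty) : StrictMono (marginalRatio u₁ v lam w) :=
  fun x y hxy => by
    rw [marginalRatio_eq hv hlam hD, marginalRatio_eq hv hlam hD]
    exact div_lt_div₀ (strictAnti_aggregateMarginal hv hlam hD (by linarith))
      (hu.strictAnti_deriv hxy).le (aggregateMarginal_pos hv hlam hD _).le (hu.deriv_pos y)

theorem continuous_marginalRatio [NeZero N] (hu : IsUtilityFunction u₁)
    (hv : ∀ i, IsUtilityFunction (v i)) (hlam : ∀ i, 0 < lam i)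
    (hD : (aggregateDomain v lam).Nonempty) : Continuous (marginalRatio u₁ v lam w) := by
  rw [funext fun x => marginalRatio_eq (u₁ := u₁) (w := w) hv hlam hD x]
  exact ((continuous_aggregateMarginal hv hlam hD).comp (continuous_sub_left w)).div
    hu.continuous_deriv fun x => (hu.deriv_pos x).ne'

/-- First order comparison for the problem of the RDU agent at the slope `s`. -/
theorem objective_lt [NeZero N] (hu : IsUtilityFunction u₁)
    (hv : ∀ i, IsUtilityFunction (v i)) (hlam : ∀ i, 0 < lam i)
    (hD : (aggregateDomain v lam).Nonempty) {s a q : ℝ} (hs : 0 ≤ s) (hq : q ≠ a)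
    (h : (s - marginalRatio u₁ v lam w a) * (q - a) ≤ 0) :
    s * u₁ q + aggregateUtility v lam (w - q) < s * u₁ a + aggregateUtility v lam (w - a) := by
  have h1 := mul_le_mul_of_nonneg_left (hu.le_tangent a q) hs
  have h2 := aggregateUtility_lt_tangent hv hlam hD
    (show w - q ≠ w - a from fun h => hq (by linarith))
  -- With this identity the two tangent slopes at `a` combine to `u₁'(a) (s - m_λ(a)) (q - a)`.
  have h3 : aggregateMarginal v lam (w - a) = marginalRatio u₁ v lam w a * deriv u₁ a := by
    rw [marginalRatio_eq hv hlam hD, div_mul_cancel₀ _ (hu.deriv_pos a).ne']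
  have h4 := mul_nonpos_of_nonneg_of_nonpos (hu.deriv_pos a).le h
  rw [h3] at h2
  nlinarith

end Aggregate

/-! ### The convex envelope -/

section Envelope

variable {f : ℝ → ℝ}

/-- On `[0,1]` the set of values in the definition is bounded by `f x`, so its `sSup` is a true
supremum. Nonemptiness comes from the zero minorant, which is why `0 ≤ f` is assumed below. -/
theorem le_convexEnvelope {g : ℝ → ℝ} (hg : ConvexOn ℝ (Icc 0 1) g)
    (hgf : ∀ t ∈ Icc (0 : ℝ) 1, g t ≤ f t) {x : ℝ} (hx : x ∈ Icc (0 : ℝ) 1) :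
    g x ≤ convexEnvelope f x :=
  le_csSup ⟨f x, by rintro y ⟨g, -, hg, rfl⟩; exact hg x hx⟩ ⟨g, hg, hgf, rfl⟩

theorem convexEnvelope_nonneg (hf : ∀ t ∈ Icc (0 : ℝ) 1, 0 ≤ f t) {x : ℝ}
    (hx : x ∈ Icc (0 : ℝ) 1) : 0 ≤ convexEnvelope f x :=
  le_convexEnvelope (convexOn_const 0 (convex_Icc 0 1)) hf hx

theorem convexEnvelope_le_of_forall (hf : ∀ t ∈ Icc (0 : ℝ) 1, 0 ≤ f t) {x c : ℝ}
    (h : ∀ g : ℝ → ℝ, ConvexOn ℝ (Icc 0 1) g → (∀ t ∈ Icc (0 : ℝ) 1, g t ≤ f t) → g x ≤ c) :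
    convexEnvelope f x ≤ c :=
  csSup_le ⟨0, fun _ => 0, convexOn_const 0 (convex_Icc 0 1), hf, rfl⟩
    (by rintro y ⟨g, hg, hgf, rfl⟩; exact h g hg hgf)

theorem convexEnvelope_le (hf : ∀ t ∈ Icc (0 : ℝ) 1, 0 ≤ f t) {x : ℝ}
    (hx : x ∈ Icc (0 : ℝ) 1) : convexEnvelope f x ≤ f x :=
  convexEnvelope_le_of_forall hf fun _ _ hg => hg x hx

theorem convexOn_convexEnvelope (hf : ∀ t ∈ Icc (0 : ℝ) 1, 0 ≤ f t) :
    ConvexOn ℝ (Icc 0 1) (convexEnvelope f) := by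
  refine ⟨convex_Icc 0 1, fun x hx y hy a b ha hb hab => ?_⟩
  refine convexEnvelope_le_of_forall hf fun g hg hgf => (hg.2 hx hy ha hb hab).trans ?_
  simp only [smul_eq_mul]
  exact add_le_add (mul_le_mul_of_nonneg_left (le_convexEnvelope hg hgf hx) ha)
    (mul_le_mul_of_nonneg_left (le_convexEnvelope hg hgf hy) hb)

theorem convexEnvelope_zero (hf : ∀ t ∈ Icc (0 : ℝ) 1, 0 ≤ f t) (h0 : f 0 = 0) :
    convexEnvelope f 0 = 0 :=
  le_antisymm ((convexEnvelope_le hf (by simp)).trans_eq h0) (convexEnvelope_nonneg hf (by simp))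

theorem convexOn_affine (c k p : ℝ) (s : Set ℝ) (hs : Convex ℝ s) :
    ConvexOn ℝ s fun t => c + k * (t - p) := by
  refine ⟨hs, fun x _ y _ a b _ _ hab => le_of_eq ?_⟩
  simp only [smul_eq_mul]
  obtain rfl : b = 1 - a := by linarith
  ring

/-- A steep affine minorant near the right end point. -/
theorem exists_affine_le_convexEnvelope (hf : ∀ t ∈ Icc (0 : ℝ) 1, 0 ≤ f t)
    (hc : ContinuousWithinAt f (Icc 0 1) 1) {c : ℝ} (hcf : c < f 1) :
    ∃ k, ∀ t ∈ Icc (0 : ℝ) 1, c + k * (t - 1) ≤ convexEnvelope f t := by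
  have h1 := hc.eventually (lt_mem_nhds hcf)
  rw [eventually_nhdsWithin_iff, Metric.eventually_nhds_iff] at h1
  obtain ⟨η, hη, h1⟩ := h1
  -- Within `η` of `1` the line is at most `c < f`; farther away this slope has brought it down to
  -- at most `c - |c| ≤ 0 ≤ f`.
  refine ⟨|c| / η, fun t ht => le_convexEnvelope
    (convexOn_affine _ _ _ _ (convex_Icc 0 1)) (fun s hs => ?_) ht⟩
  have hk : 0 ≤ |c| / η := by positivity
  by_cases hsη : dist s 1 < η
  · have h2 := h1 hsη hs
    have h3 := mul_nonpos_of_nonneg_of_nonpos hk (sub_nonpos.2 hs.2)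
    linarith
  · rw [not_lt, Real.dist_eq, abs_sub_comm, abs_of_nonneg (sub_nonneg.2 hs.2)] at hsη
    have h2 := mul_le_mul_of_nonneg_left hsη hk
    rw [div_mul_cancel₀ _ hη.ne'] at h2
    have h3 := hf s hs
    have h4 := le_abs_self c
    linarith

theorem convexEnvelope_one (hf : ∀ t ∈ Icc (0 : ℝ) 1, 0 ≤ f t)
    (hc : ContinuousOn f (Icc 0 1)) : convexEnvelope f 1 = f 1 := by
  refine le_antisymm (convexEnvelope_le hf (by simp)) (le_of_forall_lt fun c hcf => ?_)
  obtain ⟨d, hcd, hdf⟩ := exists_between hcf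
  obtain ⟨k, hk⟩ := exists_affine_le_convexEnvelope hf (hc 1 (by simp)) hdf
  have := hk 1 (by simp)
  linarith

/-- Convexity gives only interior continuity. At `0` the envelope is squeezed between `0` and `f`,
at `1` between steep affine minorants and `f`. -/
theorem continuousOn_convexEnvelope (hf : ∀ t ∈ Icc (0 : ℝ) 1, 0 ≤ f t) (h0 : f 0 = 0)
    (hc : ContinuousOn f (Icc 0 1)) : ContinuousOn (convexEnvelope f) (Icc 0 1) := by
  intro x hx
  rcases eq_or_lt_of_le hx.1 with rfl | hx0
  · rw [ContinuousWithinAt, convexEnvelope_zero hf h0]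
    have h1 := hc 0 hx
    rw [ContinuousWithinAt, h0] at h1
    refine tendsto_of_tendsto_of_tendsto_of_le_of_le' tendsto_const_nhds h1 ?_ ?_
    · filter_upwards [self_mem_nhdsWithin] with t ht using convexEnvelope_nonneg hf ht
    · filter_upwards [self_mem_nhdsWithin] with t ht using convexEnvelope_le hf ht
  rcases eq_or_lt_of_le hx.2 with rfl | hx1
  · rw [ContinuousWithinAt, convexEnvelope_one hf hc]
    refine tendsto_order.2 ⟨fun a ha => ?_, fun a ha => ?_⟩
    · obtain ⟨d, had, hdf⟩ := exists_between ha
      obtain ⟨k, hk⟩ := exists_affine_le_convexEnvelope hf (hc 1 hx) hdf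
      have h2 : Tendsto (fun t : ℝ => d + k * (t - 1)) (𝓝[Icc 0 1] 1) (𝓝 (d + k * (1 - 1))) :=
        (by fun_prop : Continuous fun t : ℝ => d + k * (t - 1)).continuousWithinAt
      filter_upwards [self_mem_nhdsWithin, h2.eventually (lt_mem_nhds (a := a) (by simpa))]
        with t ht h3 using h3.trans_le (hk t ht)
    · filter_upwards [self_mem_nhdsWithin, (hc 1 hx).eventually (gt_mem_nhds ha)]
        with t ht h3 using (convexEnvelope_le hf ht).trans_lt h3
  · have h1 := (convexOn_convexEnvelope hf).continuousOn_interior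
    rw [interior_Icc] at h1
    exact (h1.continuousAt (Ioo_mem_nhds hx0 hx1)).continuousWithinAt

/-- Where the envelope is strictly below the function it is locally affine. -/
theorem exists_eventually_eq_affine (hf : ∀ t ∈ Icc (0 : ℝ) 1, 0 ≤ f t) (h0 : f 0 = 0)
    (hc : ContinuousOn f (Icc 0 1)) {t : ℝ} (ht : t ∈ Ioo (0 : ℝ) 1)
    (hlt : convexEnvelope f t < f t) :
    ∃ c k : ℝ, ∀ᶠ x in 𝓝 t, convexEnvelope f x = c + k * (x - t) := by
  have hconv := convexOn_convexEnvelope hf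
  have hnhds : Icc (0 : ℝ) 1 ∈ 𝓝 t := Icc_mem_nhds ht.1 ht.2
  -- A constant `d` separates the envelope from `f` on a whole interval `[a, b]` around `t`, so the
  -- chord of the envelope over it stays below `d`, hence below `f`.
  obtain ⟨d, hd1, hd2⟩ := exists_between hlt
  have h1 := ((continuousOn_convexEnvelope hf h0 hc).continuousAt hnhds).eventually
    (gt_mem_nhds hd1)
  have h2 := (hc.continuousAt hnhds).eventually (lt_mem_nhds hd2)
  obtain ⟨ε, hε, hball⟩ := Metric.eventually_nhds_iff.1 ((h1.and h2).and hnhds)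
  set a := t - ε / 2 with ha
  set b := t + ε / 2 with hb
  have hab : a < b := by linarith
  have hmem : ∀ x ∈ Icc a b, (convexEnvelope f x < d ∧ d < f x) ∧ x ∈ Icc (0 : ℝ) 1 :=
    fun x hx => hball (by
      rw [Real.dist_eq, abs_lt]; constructor <;> linarith [hx.1, hx.2])
  set k := (convexEnvelope f b - convexEnvelope f a) / (b - a) with hk
  have ha' := hmem a ⟨le_rfl, hab.le⟩
  have hb' := hmem b ⟨hab.le, le_rfl⟩
  have hba : 0 < b - a := sub_pos.2 hab
  have hkm : k * (b - a) = convexEnvelope f b - convexEnvelope f a := by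
    rw [hk, div_mul_cancel₀ _ hba.ne']
  set ℓ : ℝ → ℝ := fun x => convexEnvelope f a + k * (x - a) with hℓ
  -- the chord is an upper bound inside the interval and a lower bound outside
  have hin : ∀ x ∈ Icc a b, convexEnvelope f x ≤ ℓ x ∧ ℓ x ≤ f x := fun x hx => by
    have hxa : 0 ≤ (x - a) / (b - a) := div_nonneg (by linarith [hx.1]) hba.le
    have hxb : 0 ≤ (b - x) / (b - a) := div_nonneg (by linarith [hx.2]) hba.le
    have hsum : (b - x) / (b - a) + (x - a) / (b - a) = 1 := by
      field_simp; ring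
    have hcomb : (b - x) / (b - a) * a + (x - a) / (b - a) * b = x := by
      field_simp; ring
    have hval : ℓ x = (b - x) / (b - a) * convexEnvelope f a +
        (x - a) / (b - a) * convexEnvelope f b := by
      simp only [hℓ, hk]
      field_simp; ring
    have h3 := hconv.2 ha'.2 hb'.2 hxb hxa hsum
    simp only [smul_eq_mul, hcomb] at h3
    refine ⟨h3.trans_eq hval.symm, ?_⟩
    rw [hval]
    have h4 := mul_le_mul_of_nonneg_left ha'.1.1.le hxb
    have h5 := mul_le_mul_of_nonneg_left hb'.1.1.le hxa
    have h6 := (hmem x hx).1.2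
    have h7 : (b - x) / (b - a) * d + (x - a) / (b - a) * d = d := by rw [← add_mul, hsum, one_mul]
    linarith
  have hout : ∀ x ∈ Icc (0 : ℝ) 1, x ∉ Icc a b → ℓ x ≤ convexEnvelope f x := fun x hx hxab => by
    simp only [hℓ]
    rcases lt_or_ge x a with hxa | hxa
    · have h3 := hconv.slope_mono_adjacent hx hb'.2 hxa hab
      rw [← hk, div_le_iff₀ (by linarith)] at h3
      linarith
    · have hxb : b < x := by
        by_contra h; exact hxab ⟨hxa, not_lt.1 h⟩
      have h3 := hconv.slope_mono_adjacent ha'.2 hx hab hxb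
      rw [← hk, le_div_iff₀ (by linarith)] at h3
      have : k * (x - a) = k * (x - b) + k * (b - a) := by ring
      linarith
  -- Raising the envelope to its chord gives another convex minorant of `f`, so by maximality the
  -- envelope already dominates the chord.
  have hmax : ConvexOn ℝ (Icc 0 1) (convexEnvelope f ⊔ ℓ) :=
    hconv.sup (convexOn_affine _ _ _ _ (convex_Icc 0 1))
  have hle : ∀ x ∈ Icc (0 : ℝ) 1, (convexEnvelope f ⊔ ℓ) x ≤ f x := fun x hx => by
    refine sup_le (convexEnvelope_le hf hx) ?_
    by_cases hxab : x ∈ Icc a b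
    · exact (hin x hxab).2
    · exact (hout x hx hxab).trans (convexEnvelope_le hf hx)
  refine ⟨ℓ t, k, ?_⟩
  filter_upwards [Icc_mem_nhds (show a < t by linarith) (show t < b by linarith)] with x hx
  have h3 := (le_sup_right : ℓ x ≤ _).trans (le_convexEnvelope hmax hle (hmem x hx).2)
  rw [le_antisymm (hin x hx).1 h3]
  simp only [hℓ]
  ring

/-- Off the contact set the envelope is locally affine. At a contact point the tangent of `f` must
support the envelope, since otherwise convexity would contradict a one-sided slope of `f`; the
envelope is then squeezed between this tangent and `f`. -/
theorem differentiableAt_convexEnvelope (hf : ∀ t ∈ Icc (0 : ℝ) 1, 0 ≤ f t) (h0 : f 0 = 0)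
    (hc : ContinuousOn f (Icc 0 1)) (hd : DifferentiableOn ℝ f (Ioo 0 1)) {t : ℝ}
    (ht : t ∈ Ioo (0 : ℝ) 1) : DifferentiableAt ℝ (convexEnvelope f) t := by
  have hconv := convexOn_convexEnvelope hf
  have htI : t ∈ Icc (0 : ℝ) 1 := Ioo_subset_Icc_self ht
  rcases (convexEnvelope_le hf htI).lt_or_eq with hlt | heq
  · obtain ⟨c, k, h⟩ := exists_eventually_eq_affine hf h0 hc ht hlt
    exact DifferentiableAt.congr_of_eventuallyEq (by fun_prop) h
  · have hder : HasDerivAt f (deriv f t) t :=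
      (hd.differentiableAt (Ioo_mem_nhds ht.1 ht.2)).hasDerivAt
    set p := deriv f t with hp
    have hsub : ∀ x ∈ Icc (0 : ℝ) 1, f t + p * (x - t) ≤ convexEnvelope f x := by
      intro x hx
      by_contra! hlt
      have hslope := hasDerivAt_iff_tendsto_slope.1 hder
      rcases lt_trichotomy x t with hxt | rfl | hxt
      · -- slopes to the right of `t` are at least the slope of `[x, t]`
        have h1 : ∀ᶠ y in 𝓝[>] t, (f t - convexEnvelope f x) / (t - x) ≤ slope f t y := by
          filter_upwards [Ioo_mem_nhdsGT ht.2] with y hy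
          have hy' : y ∈ Icc (0 : ℝ) 1 := ⟨htI.1.trans hy.1.le, hy.2.le⟩
          have h2 := hconv.slope_mono_adjacent hx hy' hxt hy.1
          rw [heq] at h2
          rw [slope_def_field]
          refine h2.trans (div_le_div_of_nonneg_right ?_ (sub_nonneg.2 hy.1.le))
          linarith [convexEnvelope_le hf hy']
        have h3 := ge_of_tendsto (hslope.mono_left (nhdsWithin_mono t
          (show Ioi t ⊆ {t}ᶜ from fun y hy => ne_of_gt hy))) h1
        rw [div_le_iff₀ (sub_pos.2 hxt)] at h3
        linarith
      · rw [sub_self, mul_zero, add_zero, heq] at hlt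
        exact lt_irrefl _ hlt
      · have h1 : ∀ᶠ y in 𝓝[<] t, slope f t y ≤ (convexEnvelope f x - f t) / (x - t) := by
          filter_upwards [Ioo_mem_nhdsLT ht.1] with y hy
          have hy' : y ∈ Icc (0 : ℝ) 1 := ⟨hy.1.le, hy.2.le.trans htI.2⟩
          have h2 := hconv.slope_mono_adjacent hy' hx hy.2 hxt
          rw [heq] at h2
          rw [slope_comm, slope_def_field]
          refine le_trans (div_le_div_of_nonneg_right ?_ (sub_nonneg.2 hy.2.le)) h2
          linarith [convexEnvelope_le hf hy']
        have h3 := le_of_tendsto (hslope.mono_left (nhdsWithin_mono t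
          (show Iio t ⊆ {t}ᶜ from fun y hy => ne_of_lt hy))) h1
        rw [le_div_iff₀ (sub_pos.2 hxt)] at h3
        linarith
    have hline : HasDerivAt (fun x => f t + p * (x - t)) p t := by
      simpa using (((hasDerivAt_id t).sub_const t).const_mul p).const_add (f t)
    refine (hline.of_le_of_le hder ?_ ?_ (by simp [heq]) heq).differentiableAt
    · filter_upwards [Icc_mem_nhds ht.1 ht.2] with x hx using hsub x hx
    · filter_upwards [Icc_mem_nhds ht.1 ht.2] with x hx using convexEnvelope_le hf hx

theorem eventually_deriv_convexEnvelope_eq (hf : ∀ t ∈ Icc (0 : ℝ) 1, 0 ≤ f t) (h0 : f 0 = 0)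
    (hc : ContinuousOn f (Icc 0 1)) {t : ℝ} (ht : t ∈ Ioo (0 : ℝ) 1)
    (hlt : convexEnvelope f t < f t) :
    ∃ k : ℝ, ∀ᶠ x in 𝓝 t, deriv (convexEnvelope f) x = k := by
  obtain ⟨c, k, h⟩ := exists_eventually_eq_affine hf h0 hc ht hlt
  refine ⟨k, (eventually_eventually_nhds.2 h).mono fun x hx => ?_⟩
  rw [EventuallyEq.deriv_eq hx]
  have hline : HasDerivAt (fun y => c + k * (y - t)) k x := by
    simpa using (((hasDerivAt_id x).sub_const t).const_mul k).const_add c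
  exact hline.deriv

theorem deriv_convexEnvelope_nonneg (hf : ∀ t ∈ Icc (0 : ℝ) 1, 0 ≤ f t) (h0 : f 0 = 0)
    (hc : ContinuousOn f (Icc 0 1)) (hd : DifferentiableOn ℝ f (Ioo 0 1)) {t : ℝ}
    (ht : t ∈ Ioo (0 : ℝ) 1) : 0 ≤ deriv (convexEnvelope f) t := by
  have htI : t ∈ Icc (0 : ℝ) 1 := Ioo_subset_Icc_self ht
  have h1 := (convexOn_convexEnvelope hf).slope_le_deriv (by simp) htI ht.1
    (differentiableAt_convexEnvelope hf h0 hc hd ht)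
  refine le_trans ?_ h1
  rw [slope_def_field, convexEnvelope_zero hf h0, sub_zero]
  exact div_nonneg (convexEnvelope_nonneg hf htI) (by linarith [ht.1])

/-- The slope may blow up at `1`; integrability comes from its sign and from continuity of the
envelope up to the end points. -/
theorem integrableOn_deriv_convexEnvelope (hf : ∀ t ∈ Icc (0 : ℝ) 1, 0 ≤ f t) (h0 : f 0 = 0)
    (hc : ContinuousOn f (Icc 0 1)) (hd : DifferentiableOn ℝ f (Ioo 0 1)) :
    IntegrableOn (deriv (convexEnvelope f)) (Ioo 0 1) :=
  (intervalIntegral.integrableOn_deriv_of_nonneg (continuousOn_convexEnvelope hf h0 hc)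
    (fun _ ht => (differentiableAt_convexEnvelope hf h0 hc hd ht).hasDerivAt)
    fun _ ht => deriv_convexEnvelope_nonneg hf h0 hc hd ht).mono_set Ioo_subset_Ioc_self

theorem integral_deriv_convexEnvelope (hf : ∀ t ∈ Icc (0 : ℝ) 1, 0 ≤ f t) (h0 : f 0 = 0)
    (hc : ContinuousOn f (Icc 0 1)) (hd : DifferentiableOn ℝ f (Ioo 0 1)) {s : ℝ}
    (hs : s ∈ Icc (0 : ℝ) 1) :
    ∫ t in Ioo s 1, deriv (convexEnvelope f) t = f 1 - convexEnvelope f s := by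
  have hint : IntegrableOn (deriv (convexEnvelope f)) (Ioo s 1) :=
    (integrableOn_deriv_convexEnvelope hf h0 hc hd).mono_set (Ioo_subset_Ioo_left hs.1)
  rw [← integral_Ioc_eq_integral_Ioo, ← intervalIntegral.integral_of_le hs.2,
    intervalIntegral.integral_eq_sub_of_hasDerivAt_of_le hs.2
      ((continuousOn_convexEnvelope hf h0 hc).mono (Icc_subset_Icc_left hs.1))
      (fun t ht => (differentiableAt_convexEnvelope hf h0 hc hd
        ⟨hs.1.trans_lt ht.1, ht.2⟩).hasDerivAt) ?_, convexEnvelope_one hf hc]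
  rwa [intervalIntegrable_iff_integrableOn_Ioo_of_le hs.2]

end Envelope

/-! ### The conjugate distortion -/

namespace IsWeightingFunction

variable {T : ℝ → ℝ}

theorem mem_Icc (hT : IsWeightingFunction T) {t : ℝ} (ht : t ∈ Icc (0 : ℝ) 1) :
    T t ∈ Icc (0 : ℝ) 1 := hT.mapsTo ht

theorem conjugateDistortion_nonneg (hT : IsWeightingFunction T) :
    ∀ t ∈ Icc (0 : ℝ) 1, 0 ≤ conjugateDistortion T t := fun t ht =>
  sub_nonneg.2 (hT.mem_Icc ⟨by linarith [ht.2], by linarith [ht.1]⟩).2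

theorem conjugateDistortion_zero (hT : IsWeightingFunction T) : conjugateDistortion T 0 = 0 := by
  simp [conjugateDistortion, hT.map_one]

theorem conjugateDistortion_one (hT : IsWeightingFunction T) : conjugateDistortion T 1 = 1 := by
  simp [conjugateDistortion, hT.map_zero]

theorem continuousOn_conjugateDistortion (hT : IsWeightingFunction T) :
    ContinuousOn (conjugateDistortion T) (Icc 0 1) :=
  continuousOn_const.sub (hT.continuousOn.comp (by fun_prop)
    fun t ht => ⟨by linarith [ht.2], by linarith [ht.1]⟩)

theorem differentiableOn_conjugateDistortion (hT : IsWeightingFunction T) :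
    DifferentiableOn ℝ (conjugateDistortion T) (Ioo 0 1) :=
  (differentiableOn_const 1).sub (hT.differentiableOn.comp (by fun_prop)
    fun t ht => ⟨by linarith [ht.2], by linarith [ht.1]⟩)

end IsWeightingFunction

/-! ### Uniform variables on nonatomic spaces -/

section Nonatomic

variable {Ω : Type*} [MeasurableSpace Ω] {P : Measure Ω}

/-- A maximal family of measurable sets that is totally ordered by inclusion up to null sets. -/
structure IsMaxAEChain (P : Measure Ω) (M : Set (Set Ω)) : Prop where
  measurableSet : ∀ A ∈ M, MeasurableSet A
  total : ∀ A ∈ M, ∀ B ∈ M, A ≤ᵐ[P] B ∨ B ≤ᵐ[P] A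
  maximal : ∀ B, MeasurableSet B → (∀ A ∈ M, A ≤ᵐ[P] B ∨ B ≤ᵐ[P] A) → B ∈ M

theorem compl_ae_le_compl {A B : Set Ω} (h : A ≤ᵐ[P] B) : (Bᶜ : Set Ω) ≤ᵐ[P] (Aᶜ : Set Ω) := by
  filter_upwards [h] with ω hω hB hA using hB (hω hA)

theorem compl_ae_le_compl_iff {A B : Set Ω} :
    (Bᶜ : Set Ω) ≤ᵐ[P] (Aᶜ : Set Ω) ↔ A ≤ᵐ[P] B :=
  ⟨fun h => by simpa using compl_ae_le_compl h, compl_ae_le_compl⟩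

/-- Hausdorff's maximality principle for measurable sets under a.e. inclusion. -/
theorem exists_isMaxAEChain {C : Set (Set Ω)} (hC : ∀ A ∈ C, MeasurableSet A)
    (hC' : ∀ A ∈ C, ∀ B ∈ C, A ⊆ B ∨ B ⊆ A) : ∃ M, IsMaxAEChain P M ∧ C ⊆ M := by
  let r : {A : Set Ω // MeasurableSet A} → {A : Set Ω // MeasurableSet A} → Prop :=
    fun A B => A.1 ≤ᵐ[P] B.1
  have hchain : IsChain r (Subtype.val ⁻¹' C) := fun A hA B hB _ =>
    (hC' A.1 hA B.1 hB).imp LE.le.eventuallyLE LE.le.eventuallyLE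
  obtain ⟨M, hM, hCM⟩ := hchain.exists_maxChain
  refine ⟨Subtype.val '' M, ⟨?_, ?_, ?_⟩, fun A hA => ⟨⟨A, hC A hA⟩, hCM hA, rfl⟩⟩
  · rintro _ ⟨A, -, rfl⟩
    exact A.2
  · rintro _ ⟨A, hA, rfl⟩ _ ⟨B, hB, rfl⟩
    by_cases h : A = B
    · exact Or.inl (h ▸ EventuallyLE.refl _ _)
    · exact hM.1 hA hB h
  · intro B hB h
    have hins : IsChain r (insert ⟨B, hB⟩ M) :=
      hM.1.insert fun A hA _ => (h A.1 ⟨A, hA, rfl⟩).symm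
    exact ⟨⟨B, hB⟩, by rw [hM.2 hins (subset_insert _ _)]; exact mem_insert _ _, rfl⟩

namespace IsMaxAEChain

variable {M : Set (Set Ω)}

theorem compl (hM : IsMaxAEChain P M) : IsMaxAEChain P (compl ⁻¹' M) where
  measurableSet A hA := (hM.measurableSet _ hA).of_compl
  total A hA B hB := by
    rw [← compl_ae_le_compl_iff (A := A), ← compl_ae_le_compl_iff (A := B)]
    exact (hM.total _ hA _ hB).symm
  maximal B hB h := hM.maximal _ hB.compl fun A hA => by
    have := h Aᶜ (by simpa using hA)
    rw [← compl_ae_le_compl_iff (A := Aᶜ), ← compl_ae_le_compl_iff (A := B), compl_compl] at this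
    exact this.symm

theorem empty_mem (hM : IsMaxAEChain P M) : ∅ ∈ M :=
  hM.maximal ∅ MeasurableSet.empty fun A _ => Or.inr (empty_subset A).eventuallyLE

variable [IsProbabilityMeasure P]

theorem ae_le_of_measureReal_le (hM : IsMaxAEChain P M) {A B : Set Ω} (hA : A ∈ M) (hB : B ∈ M)
    (h : P.real A ≤ P.real B) : A ≤ᵐ[P] B := by
  rcases hM.total A hA B hB with h1 | h1
  · exact h1
  · have h2 : P A ≤ P B := (ENNReal.toReal_le_toReal (by finiteness) (by finiteness)).1 h
    exact (ae_eq_of_ae_subset_of_measure_ge h1 h2 (hM.measurableSet B hB).nullMeasurableSet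
      (by finiteness)).symm.le

/-- Among the members of measure at most `t` there is a largest one. -/
theorem exists_greatest (hM : IsMaxAEChain P M) {t : ℝ} (ht : 0 ≤ t) :
    ∃ A ∈ M, P.real A ≤ t ∧ ∀ B ∈ M, P.real B ≤ t → P.real B ≤ P.real A := by
  set S : Set ℝ := {x | ∃ A ∈ M, P.real A ≤ t ∧ P.real A = x} with hS
  have hbdd : BddAbove S := ⟨t, by rintro x ⟨A, -, hA, rfl⟩; exact hA⟩
  -- The union of members whose measures increase to the supremum is the candidate. It is comparable
  -- with every member, so maximality puts it in `M`.
  obtain ⟨a, ha, hlim, haS⟩ := exists_seq_tendsto_sSup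
    (⟨_, ∅, hM.empty_mem, by simpa using ht, rfl⟩ : S.Nonempty) hbdd
  choose A hAM hAt hAa using haS
  have hmono : ∀ᵐ ω ∂P, ∀ n k, n ≤ k → ω ∈ A n → ω ∈ A k := by
    rw [ae_all_iff]; intro n
    rw [ae_all_iff]; intro k
    by_cases hnk : n ≤ k
    · filter_upwards [hM.ae_le_of_measureReal_le (hAM n) (hAM k)
        (by rw [hAa, hAa]; exact ha hnk)] with ω hω _ using hω
    · simp [hnk]
  have hmeas : P.real (⋃ n, A n) ≤ t := by
    refine ENNReal.toReal_le_of_le_ofReal ht ?_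
    rw [measure_iUnion_eq_iSup_accumulate]
    refine iSup_le fun k => ?_
    refine (measure_mono_ae (t := A k) ?_).trans
      ((ENNReal.le_ofReal_iff_toReal_le (by finiteness) ht).2 (hAt k))
    filter_upwards [hmono] with ω hω hmem
    obtain ⟨n, hn, hωn⟩ := mem_accumulate.1 hmem
    exact hω n k hn hωn
  have hsub : ∀ n, A n ⊆ ⋃ n, A n := subset_iUnion A
  refine ⟨⋃ n, A n, hM.maximal _ (MeasurableSet.iUnion fun n => hM.measurableSet _ (hAM n))
    fun B hB => ?_, hmeas, fun B hB hBt => ?_⟩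
  · by_cases h : ∃ n, P.real B ≤ P.real (A n)
    · obtain ⟨n, hn⟩ := h
      exact Or.inl ((hM.ae_le_of_measureReal_le hB (hAM n) hn).trans (hsub n).eventuallyLE)
    · push Not at h
      right
      have : ∀ᵐ ω ∂P, ∀ n, ω ∈ A n → ω ∈ B :=
        ae_all_iff.2 fun n => hM.ae_le_of_measureReal_le (hAM n) hB (h n).le
      filter_upwards [this] with ω hω hmem
      obtain ⟨n, hn⟩ := mem_iUnion.1 hmem
      exact hω n hn
  · refine (le_csSup hbdd ⟨B, hB, hBt, rfl⟩).trans (le_of_tendsto' hlim fun n => ?_)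
    rw [← hAa n]
    exact measureReal_mono (hsub n)

/-- Complements of a maximal chain form a maximal chain, which turns least into greatest. -/
theorem exists_least (hM : IsMaxAEChain P M) {t : ℝ} (ht : t ≤ 1) :
    ∃ A ∈ M, t ≤ P.real A ∧ ∀ B ∈ M, t ≤ P.real B → P.real A ≤ P.real B := by
  obtain ⟨A, hA, hAt, hmax⟩ := hM.compl.exists_greatest (sub_nonneg.2 ht)
  have hcompl : ∀ B ∈ M, P.real Bᶜ = 1 - P.real B := fun B hB => by
    rw [probReal_compl_eq_one_sub (hM.measurableSet B hB)]
  have hA' : P.real A = 1 - P.real Aᶜ := by rw [← hcompl _ hA, compl_compl]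
  refine ⟨Aᶜ, hA, by linarith, fun B hB hBt => ?_⟩
  have := hmax Bᶜ (by simpa using hB) (by rw [hcompl B hB]; linarith)
  rw [hcompl B hB] at this
  linarith

/-- On a nonatomic space the members of a maximal chain take all values. -/
theorem exists_measureReal_eq (hM : IsMaxAEChain P M) (hP : IsNonatomic P) {t : ℝ}
    (ht : t ∈ Icc (0 : ℝ) 1) : ∃ A ∈ M, P.real A = t := by
  obtain ⟨A, hA, hAt, hAmax⟩ := hM.exists_greatest ht.1
  obtain ⟨B, hB, hBt, hBmin⟩ := hM.exists_least ht.2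
  have hAm := hM.measurableSet A hA
  have hBm := hM.measurableSet B hB
  by_contra! hne
  have hAlt : P.real A < t := hAt.lt_of_ne (hne A hA)
  have hAB : A ≤ᵐ[P] B := hM.ae_le_of_measureReal_le hA hB (hAt.trans hBt)
  have hdiff : P.real (B \ A) = P.real B - P.real A := by
    have h1 : P.real (B ∩ A) = P.real A := by
      refine measureReal_congr ?_
      filter_upwards [hAB] with ω hω
      exact propext ⟨fun h => h.2, fun h => ⟨hω h, h⟩⟩
    have h2 := measureReal_inter_add_sdiff (μ := P) (s := B) hAm
    linarith
  have hpos : 0 < P (B \ A) := by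
    rw [pos_iff_ne_zero]
    intro h
    rw [measureReal_def, h, ENNReal.toReal_zero] at hdiff
    linarith
  -- If `t` is skipped, nonatomicity splits the gap `B \ A`. The set `A ∪ D` is comparable with
  -- every member, so it lies in `M`, yet its measure is strictly between those of `A` and `B`.
  obtain ⟨D, hDsub, hDm, hD0, hDlt⟩ := hP _ (hBm.diff hAm) hpos
  have hD0' : 0 < P.real D := ENNReal.toReal_pos hD0.ne' (by finiteness)
  have hDlt' : P.real D < P.real (B \ A) :=
    (ENNReal.toReal_lt_toReal (by finiteness) (by finiteness)).2 hDlt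
  have hunion : P.real (A ∪ D) = P.real A + P.real D :=
    measureReal_union (disjoint_left.2 fun ω h1 h2 => (hDsub h2).2 h1) hDm
  have hmem : A ∪ D ∈ M := hM.maximal _ (hAm.union hDm) fun E hE => by
    rcases le_or_gt (P.real E) t with hEt | hEt
    · exact Or.inl ((hM.ae_le_of_measureReal_le hE hA (hAmax E hE hEt)).trans
        subset_union_left.eventuallyLE)
    · refine Or.inr (EventuallyLE.trans ?_ (hM.ae_le_of_measureReal_le hB hE (hBmin E hE hEt.le)))
      filter_upwards [hAB] with ω hω h
      exact h.elim hω fun h => (hDsub h).1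
  rcases le_or_gt (P.real (A ∪ D)) t with h | h
  · linarith [hAmax _ hmem h]
  · linarith [hBmin _ hmem h.le]

/-- A maximal chain on a nonatomic space is indexed by a uniform variable. -/
theorem exists_uniform (hM : IsMaxAEChain P M) (hP : IsNonatomic P) :
    ∃ U : Ω → ℝ, Measurable U ∧ pdf.IsUniform U (Ioo 0 1) P volume ∧
      ∀ B ∈ M, {ω | U ω < P.real B} =ᵐ[P] B := by
  have hex : ∀ q : Icc (0 : ℚ) 1, ∃ A ∈ M, P.real A = (q.1 : ℝ) := fun q =>
    hM.exists_measureReal_eq hP ⟨by exact_mod_cast q.2.1, by exact_mod_cast q.2.2⟩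
  choose A hAM hAq using hex
  classical
  -- `U` will be the least index `q` with `ω ∈ A q`, as an infimum over rationals. The default `1`
  -- never falls below a level `t ≤ 1`, so `{U < t}` is exactly the union of the `A q` with `q < t`.
  set F : Icc (0 : ℚ) 1 → Ω → ℝ := fun q ω => if ω ∈ A q then (q.1 : ℝ) else 1 with hF
  have hF0 : ∀ q ω, 0 ≤ F q ω := fun q ω => by
    simp only [hF]
    split_ifs
    · exact_mod_cast q.2.1
    · exact zero_le_one
  have hF1 : ∀ q ω, F q ω ≤ 1 := fun q ω => by
    simp only [hF]
    split_ifs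
    · exact_mod_cast q.2.2
    · exact le_rfl
  have : Nonempty (Icc (0 : ℚ) 1) := ⟨⟨0, by simp⟩⟩
  have hbdd : ∀ ω, BddBelow (range fun q => F q ω) := fun ω =>
    ⟨0, by rintro _ ⟨q, rfl⟩; exact hF0 q ω⟩
  set U : Ω → ℝ := fun ω => ⨅ q, F q ω with hU
  have hUm : Measurable U := Measurable.iInf fun q =>
    Measurable.ite (hM.measurableSet _ (hAM q)) measurable_const measurable_const
  have hU0 : ∀ ω, 0 ≤ U ω := fun ω => le_ciInf fun q => hF0 q ω
  have hU1 : ∀ ω, U ω ≤ 1 := fun ω => (ciInf_le (hbdd ω) ⟨0, by simp⟩).trans (hF1 _ ω)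
  have hUlt : ∀ ω, ∀ t ≤ (1 : ℝ), U ω < t ↔ ∃ q : Icc (0 : ℚ) 1, (q.1 : ℝ) < t ∧ ω ∈ A q :=
    fun ω t ht => by
      rw [hU, ciInf_lt_iff (hbdd ω)]
      refine exists_congr fun q => ?_
      simp only [hF]
      split_ifs with h
      · simp [h]
      · simp [h, ht]
  have hge : ∀ t ∈ Icc (0 : ℝ) 1, t ≤ P.real {ω | U ω < t} := fun t ht => by
    refine le_of_forall_lt fun s hst => ?_
    rcases lt_or_ge s 0 with hs | hs
    · exact hs.trans_le measureReal_nonneg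
    obtain ⟨q, hsq, hqt⟩ := exists_rat_btwn hst
    have hq : q ∈ Icc (0 : ℚ) 1 :=
      ⟨by exact_mod_cast hs.trans hsq.le, by exact_mod_cast hqt.le.trans ht.2⟩
    refine hsq.trans_le ((hAq ⟨q, hq⟩).symm.trans_le (measureReal_mono fun ω hω => ?_))
    exact (hUlt ω t ht.2).2 ⟨⟨q, hq⟩, hqt, hω⟩
  have hle : ∀ B ∈ M, {ω | U ω < P.real B} ≤ᵐ[P] B := fun B hB => by
    have : ∀ᵐ ω ∂P, ∀ q : Icc (0 : ℚ) 1, (q.1 : ℝ) < P.real B → ω ∈ A q → ω ∈ B := by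
      rw [ae_all_iff]
      intro q
      by_cases hq : (q.1 : ℝ) < P.real B
      · filter_upwards [hM.ae_le_of_measureReal_le (hAM q) hB (by rw [hAq]; exact hq.le)]
          with ω hω _ using hω
      · simp [hq]
    filter_upwards [this] with ω hω h
    obtain ⟨q, hq, hmem⟩ := (hUlt ω _ measureReal_le_one).1 h
    exact hω q hq hmem
  have heq : ∀ B ∈ M, {ω | U ω < P.real B} =ᵐ[P] B := fun B hB =>
    ae_eq_of_ae_subset_of_measure_ge (hle B hB)
      ((ENNReal.toReal_le_toReal (by finiteness) (by finiteness)).1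
        (hge _ ⟨measureReal_nonneg, measureReal_le_one⟩))
      (measurableSet_lt hUm measurable_const).nullMeasurableSet (by finiteness)
  have hlaw : ∀ t ∈ Icc (0 : ℝ) 1, P {ω | U ω < t} = ENNReal.ofReal t := fun t ht => by
    obtain ⟨B, hB, hBt⟩ := hM.exists_measureReal_eq hP ht
    have := measure_congr (heq B hB)
    rw [hBt] at this
    rw [this, ← hBt, ofReal_measureReal]
  refine ⟨U, hUm, ?_, heq⟩
  have := Measure.isProbabilityMeasure_map (μ := P) hUm.aemeasurable
  refine Measure.ext_of_Ici _ _ fun t => ?_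
  have hcompl : U ⁻¹' Ici t = {ω | U ω < t}ᶜ := by ext ω; simp
  rw [Measure.map_apply hUm measurableSet_Ici, ProbabilityTheory.cond_apply measurableSet_Ioo]
  simp only [Real.volume_Ioo, sub_zero, ENNReal.ofReal_one, inv_one, one_mul]
  rcases le_or_gt t 0 with h0 | h0
  · have h1 : U ⁻¹' Ici t = univ := eq_univ_of_forall fun ω => h0.trans (hU0 ω)
    have h2 : Ioo (0 : ℝ) 1 ∩ Ici t = Ioo 0 1 :=
      inter_eq_left.2 fun x hx => h0.trans hx.1.le
    rw [h1, h2]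
    simp
  rcases le_or_gt t 1 with h1 | h1
  · have h2 : Ioo (0 : ℝ) 1 ∩ Ici t = Ico t 1 := by
      ext x
      simp only [mem_inter_iff, mem_Ioo, mem_Ici, mem_Ico]
      exact ⟨fun h => ⟨h.2, h.1.2⟩, fun h => ⟨⟨h0.trans_le h.1, h.2⟩, h.1⟩⟩
    rw [hcompl, prob_compl_eq_one_sub (measurableSet_lt hUm measurable_const),
      hlaw t ⟨h0.le, h1⟩, h2, Real.volume_Ico, ENNReal.ofReal_sub _ h0.le, ENNReal.ofReal_one]
  · have h2 : Ioo (0 : ℝ) 1 ∩ Ici t = ∅ := by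
      ext x
      simp only [mem_inter_iff, mem_Ioo, mem_Ici, mem_empty_iff_false, iff_false]
      rintro ⟨h3, h4⟩
      linarith
    have h3 : U ⁻¹' Ici t = ∅ := eq_empty_of_forall_notMem fun ω hω =>
      (h1.trans_le hω).not_ge (hU1 ω)
    rw [h2, h3]
    simp

end IsMaxAEChain

/-- Off a null set, `Y` is larger where `U` is larger. -/
def AEComonotone (P : Measure Ω) (U Y : Ω → ℝ) : Prop :=
  ∃ G : Set Ω, (∀ᵐ ω ∂P, ω ∈ G) ∧ ∀ ω ∈ G, ∀ ω' ∈ G, U ω < U ω' → Y ω ≤ Y ω'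

theorem AEComonotone.comp {U Y : Ω → ℝ} (h : AEComonotone P U Y) {g : ℝ → ℝ} (hg : Monotone g) :
    AEComonotone P U fun ω => g (Y ω) :=
  let ⟨G, hG, h⟩ := h
  ⟨G, hG, fun ω hω ω' hω' hlt => hg (h ω hω ω' hω' hlt)⟩

/-- Every random variable on a nonatomic space is a nondecreasing function of some uniform
variable. -/
theorem exists_uniform_aeComonotone [IsProbabilityMeasure P] (hP : IsNonatomic P) {Y : Ω → ℝ}
    (hY : AEMeasurable Y P) :
    ∃ U : Ω → ℝ, Measurable U ∧ pdf.IsUniform U (Ioo 0 1) P volume ∧ AEComonotone P U Y := by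
  set Z := hY.mk Y with hZ
  have hZm : Measurable Z := hY.measurable_mk
  have hsets : ∀ A ∈ range fun x : ℝ => {ω | Z ω ≤ x}, MeasurableSet A := by
    rintro _ ⟨x, rfl⟩
    exact measurableSet_le hZm measurable_const
  have htot : ∀ A ∈ range fun x : ℝ => {ω | Z ω ≤ x}, ∀ B ∈ range fun x : ℝ => {ω | Z ω ≤ x},
      A ⊆ B ∨ B ⊆ A := by
    rintro _ ⟨x, rfl⟩ _ ⟨y, rfl⟩
    rcases le_total x y with h | h
    · exact Or.inl fun ω hω => le_trans hω h
    · exact Or.inr fun ω hω => le_trans hω h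
  obtain ⟨M, hM, hCM⟩ := exists_isMaxAEChain (P := P) hsets htot
  obtain ⟨U, hUm, hU, hUM⟩ := hM.exists_uniform hP
  have hall : ∀ᵐ ω ∂P, ∀ q : ℚ, U ω < P.real {ω | Z ω ≤ q} ↔ Z ω ≤ q := by
    rw [ae_all_iff]
    intro q
    filter_upwards [hUM _ (hCM ⟨(q : ℝ), rfl⟩)] with ω hω using iff_of_eq hω
  -- Rational levels suffice to separate values of `Z` and keep the exceptional set null.
  refine ⟨U, hUm, hU, {ω | (∀ q : ℚ, U ω < P.real {ω | Z ω ≤ q} ↔ Z ω ≤ q) ∧ Y ω = Z ω}, ?_, ?_⟩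
  · filter_upwards [hall, hY.ae_eq_mk] with ω h1 h2 using ⟨h1, h2⟩
  · rintro ω ⟨h1, h2⟩ ω' ⟨h1', h2'⟩ hlt
    rw [h2, h2']
    by_contra! hcon
    obtain ⟨q, hq, hq'⟩ := exists_rat_btwn hcon
    exact hq'.not_ge ((h1 q).1 (hlt.trans ((h1' q).2 hq.le)))

end Nonatomic

/-! ### Choquet integrals -/

section Choquet

theorem integrableOn_Ioi_of_antitone {φ : ℝ → ℝ} (hφ : Antitone φ) {C : ℝ}
    (h : ∀ x, C ≤ x → φ x = 0) : IntegrableOn φ (Ioi 0) := by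
  have h1 : IntegrableOn φ (Icc 0 C) := (hφ.antitoneOn _).integrableOn_isCompact isCompact_Icc
  refine (h1.mono_set Ioc_subset_Icc_self).of_forall_sdiff_eq_zero measurableSet_Ioi
    fun x hx => h x ?_
  by_contra! hlt
  exact hx.2 ⟨hx.1, hlt.le⟩

theorem integrableOn_Iio_of_antitone {φ : ℝ → ℝ} (hφ : Antitone φ) {C : ℝ}
    (h : ∀ x, x < C → φ x = 0) : IntegrableOn φ (Iio 0) := by
  have h1 : IntegrableOn φ (Icc C 0) := (hφ.antitoneOn _).integrableOn_isCompact isCompact_Icc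
  refine (h1.mono_set Ico_subset_Icc_self).of_forall_sdiff_eq_zero measurableSet_Iio
    fun x hx => h x ?_
  by_contra! hlt
  exact hx.2 ⟨hlt, hx.1⟩

/-- Choquet integrals are monotone in the set function on the upper level sets of a bounded
function. -/
theorem choquetIntegral_mono {Ω : Type*} {ν ν' : Set Ω → ℝ} {Z : Ω → ℝ} {C : ℝ}
    (hν : Antitone fun x : ℝ => ν {ω | x < Z ω}) (hν' : Antitone fun x : ℝ => ν' {ω | x < Z ω})
    (hν0 : ∀ x, C ≤ x → ν {ω | x < Z ω} = 0) (hν0' : ∀ x, C ≤ x → ν' {ω | x < Z ω} = 0)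
    (hν1 : ∀ x, x < -C → ν {ω | x < Z ω} = ν univ)
    (hν1' : ∀ x, x < -C → ν' {ω | x < Z ω} = ν' univ) (huniv : ν univ = ν' univ)
    (hle : ∀ x : ℝ, ν {ω | x < Z ω} ≤ ν' {ω | x < Z ω}) :
    choquetIntegral ν Z ≤ choquetIntegral ν' Z := by
  refine add_le_add (setIntegral_mono (integrableOn_Ioi_of_antitone hν hν0)
    (integrableOn_Ioi_of_antitone hν' hν0') hle) (setIntegral_mono ?_ ?_ fun x => ?_)
  · exact integrableOn_Iio_of_antitone (fun x y hxy => sub_le_sub_right (hν hxy) _)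
      fun x hx => sub_eq_zero.2 (hν1 x hx)
  · exact integrableOn_Iio_of_antitone (fun x y hxy => sub_le_sub_right (hν' hxy) _)
      fun x hx => sub_eq_zero.2 (hν1' x hx)
  · simp only [huniv]
    exact sub_le_sub_right (hle x) _

variable {Ω : Type*} [MeasurableSpace Ω] {P : Measure Ω}

/-- The layer cake formula, applied to the positive and negative parts. -/
theorem choquetIntegral_measureReal {Q : Measure Ω} [IsProbabilityMeasure Q] {Z : Ω → ℝ}
    (hZ : Integrable Z Q) : choquetIntegral Q.real Z = ∫ ω, Z ω ∂Q := by
  have hpos : ∫ ω, max (Z ω) 0 ∂Q = ∫ x in Ioi (0 : ℝ), Q.real {ω | x < Z ω} := by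
    rw [hZ.pos_part.integral_eq_integral_meas_lt (ae_of_all _ fun ω => le_max_right _ _)]
    refine setIntegral_congr_fun measurableSet_Ioi fun x (hx : 0 < x) => ?_
    simp only [lt_max_iff, hx.not_gt, or_false]
  have hneg : ∫ ω, max (-Z ω) 0 ∂Q = -∫ x in Iio (0 : ℝ), (Q.real {ω | x < Z ω} - Q.real univ) := by
    rw [hZ.neg_part.integral_eq_integral_meas_le (ae_of_all _ fun ω => le_max_right _ _),
      ← integral_neg, ← integral_Iic_eq_integral_Iio]
    have h1 : ∫ x in Ioi (0 : ℝ), Q.real {ω | x ≤ max (-Z ω) 0} =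
        ∫ x in Ioi (0 : ℝ), (fun y => Q.real {ω | Z ω ≤ y}) (-x) := by
      refine setIntegral_congr_fun measurableSet_Ioi fun x (hx : 0 < x) => ?_
      simp only [le_max_iff, hx.not_ge, or_false, le_neg]
    rw [h1, integral_comp_neg_Ioi 0 fun y => Q.real {ω | Z ω ≤ y}, neg_zero]
    refine setIntegral_congr_fun measurableSet_Iic fun x _ => ?_
    have h2 : {ω | Z ω ≤ x} = {ω | x < Z ω}ᶜ := by ext ω; simp
    have h3 : NullMeasurableSet {ω | x < Z ω} Q :=
      nullMeasurableSet_lt aemeasurable_const hZ.aemeasurable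
    simp only [h2, probReal_univ]
    rw [probReal_compl_eq_one_sub₀ h3]
    ring
  rw [choquetIntegral, ← hpos]
  have h4 : ∫ ω, Z ω ∂Q = ∫ ω, max (Z ω) 0 ∂Q - ∫ ω, max (-Z ω) 0 ∂Q := by
    rw [← integral_sub hZ.pos_part hZ.neg_part]
    refine integral_congr_ae (ae_of_all _ fun ω => ?_)
    rcases le_total (Z ω) 0 with h | h
    · simp [h]
    · simp [h]
  rw [h4, hneg]
  ring

theorem measureReal_lt_eq_zero {Q : Measure Ω} {Z : Ω → ℝ} {C : ℝ}
    (hZ : ∀ᵐ ω ∂Q, |Z ω| ≤ C) {x : ℝ} (hx : C ≤ x) : Q.real {ω | x < Z ω} = 0 := by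
  have : Q {ω | x < Z ω} = 0 := by
    rw [measure_eq_zero_iff_ae_notMem]
    filter_upwards [hZ] with ω hω
    exact not_lt.2 ((le_abs_self _).trans (hω.trans hx))
  rw [measureReal_def, this, ENNReal.toReal_zero]

theorem measureReal_lt_eq_univ {Q : Measure Ω} {Z : Ω → ℝ} {C : ℝ}
    (hZ : ∀ᵐ ω ∂Q, |Z ω| ≤ C) {x : ℝ} (hx : x < -C) : Q.real {ω | x < Z ω} = Q.real univ := by
  refine measureReal_congr ?_
  filter_upwards [hZ] with ω hω
  exact propext ⟨fun _ => trivial, fun _ => hx.trans_le (abs_le.1 hω).1⟩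

theorem antitone_measureReal_lt {Q : Measure Ω} [IsFiniteMeasure Q] (Z : Ω → ℝ) :
    Antitone fun x : ℝ => Q.real {ω | x < Z ω} := fun _ _ hxy =>
  measureReal_mono fun _ hω => lt_of_le_of_lt hxy hω

theorem IsWeightingFunction.choquetIntegral_le [IsProbabilityMeasure P] {T : ℝ → ℝ}
    (hT : IsWeightingFunction T) {Q : Measure Ω} [IsProbabilityMeasure Q] (hQ : Q ≪ P)
    {Z : Ω → ℝ} (hZm : AEStronglyMeasurable Z P) {C : ℝ} (hZ : ∀ᵐ ω ∂P, |Z ω| ≤ C)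
    (hle : ∀ x : ℝ, T (P.real {ω | x < Z ω}) ≤ Q.real {ω | x < Z ω}) :
    choquetIntegral (fun A => T (P.real A)) Z ≤ ∫ ω, Z ω ∂Q := by
  have hZQ : ∀ᵐ ω ∂Q, |Z ω| ≤ C := hQ.ae_le hZ
  have hmem : ∀ A : Set Ω, P.real A ∈ Icc (0 : ℝ) 1 := fun A =>
    ⟨measureReal_nonneg, measureReal_le_one⟩
  rw [← choquetIntegral_measureReal (Integrable.of_bound (hZm.mono_ac hQ) C hZQ)]
  refine choquetIntegral_mono (C := C)
    (fun x y hxy => hT.strictMonoOn.monotoneOn (hmem _) (hmem _) (antitone_measureReal_lt Z hxy))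
    (antitone_measureReal_lt Z) (fun x hx => ?_) (fun x hx => measureReal_lt_eq_zero hZQ hx)
    (fun x hx => ?_) (fun x hx => measureReal_lt_eq_univ hZQ hx) ?_ hle
  · rw [measureReal_lt_eq_zero hZ hx, hT.map_zero]
  · rw [measureReal_lt_eq_univ hZ hx]
  · simp [hT.map_one]

end Choquet

/-! ### The change of measure given by the convex envelope -/

section Density

variable {Ω : Type*} [MeasurableSpace Ω] {P : Measure Ω}
  {T : ℝ → ℝ} {U : Ω → ℝ}

/-- The slope of the convex envelope of the conjugate distortion. -/
noncomputable def envelopeSlope (T : ℝ → ℝ) : ℝ → ℝ :=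
  deriv (convexEnvelope (conjugateDistortion T))

theorem measurable_envelopeSlope : Measurable (envelopeSlope T) := measurable_deriv _

namespace IsWeightingFunction

theorem envelopeSlope_nonneg (hT : IsWeightingFunction T) {t : ℝ} (ht : t ∈ Ioo (0 : ℝ) 1) :
    0 ≤ envelopeSlope T t :=
  deriv_convexEnvelope_nonneg hT.conjugateDistortion_nonneg hT.conjugateDistortion_zero
    hT.continuousOn_conjugateDistortion hT.differentiableOn_conjugateDistortion ht

theorem monotoneOn_envelopeSlope (hT : IsWeightingFunction T) :
    MonotoneOn (envelopeSlope T) (Ioo 0 1) :=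
  ((convexOn_convexEnvelope hT.conjugateDistortion_nonneg).subset Ioo_subset_Icc_self
    (convex_Ioo 0 1)).monotoneOn_deriv fun _ ht => differentiableAt_convexEnvelope
      hT.conjugateDistortion_nonneg hT.conjugateDistortion_zero
      hT.continuousOn_conjugateDistortion hT.differentiableOn_conjugateDistortion ht

theorem integrableOn_envelopeSlope (hT : IsWeightingFunction T) :
    IntegrableOn (envelopeSlope T) (Ioo 0 1) :=
  integrableOn_deriv_convexEnvelope hT.conjugateDistortion_nonneg hT.conjugateDistortion_zero
    hT.continuousOn_conjugateDistortion hT.differentiableOn_conjugateDistortion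

theorem integral_envelopeSlope (hT : IsWeightingFunction T) {s : ℝ} (hs : s ∈ Icc (0 : ℝ) 1) :
    ∫ t in Ioo s 1, envelopeSlope T t = 1 - convexEnvelope (conjugateDistortion T) s := by
  have h := integral_deriv_convexEnvelope hT.conjugateDistortion_nonneg
    hT.conjugateDistortion_zero hT.continuousOn_conjugateDistortion
    hT.differentiableOn_conjugateDistortion hs
  rwa [hT.conjugateDistortion_one] at h

end IsWeightingFunction

theorem map_eq_restrict_of_isUniform (hU : pdf.IsUniform U (Ioo 0 1) P volume) :
    P.map U = (volume : Measure ℝ).restrict (Ioo 0 1) := by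
  rw [hU, ProbabilityTheory.cond]
  simp

theorem ae_mem_Ioo_of_isUniform (hUm : Measurable U) (hU : pdf.IsUniform U (Ioo 0 1) P volume) :
    ∀ᵐ ω ∂P, U ω ∈ Ioo (0 : ℝ) 1 := by
  refine ae_of_ae_map (p := fun t => t ∈ Ioo (0 : ℝ) 1) hUm.aemeasurable ?_
  rw [map_eq_restrict_of_isUniform hU]
  exact ae_restrict_mem measurableSet_Ioo

theorem ae_ne_of_isUniform (hUm : Measurable U) (hU : pdf.IsUniform U (Ioo 0 1) P volume)
    (s : ℝ) : ∀ᵐ ω ∂P, U ω ≠ s := by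
  refine ae_of_ae_map (p := fun t => t ≠ s) hUm.aemeasurable ?_
  rw [map_eq_restrict_of_isUniform hU]
  exact ae_restrict_of_ae (Measure.ae_ne volume s)

theorem exists_mem_Ioo_of_isUniform (hUm : Measurable U)
    (hU : pdf.IsUniform U (Ioo 0 1) P volume) {G : Set Ω} (hG : ∀ᵐ ω ∂P, ω ∈ G) {a b : ℝ}
    (ha : 0 ≤ a) (hab : a < b) (hb : b ≤ 1) : ∃ ω ∈ G, U ω ∈ Ioo a b := by
  by_contra! h
  have h1 : P (U ⁻¹' Ioo a b) = 0 := by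
    rw [measure_eq_zero_iff_ae_notMem]
    filter_upwards [hG] with ω hω using h ω hω
  rw [← Measure.map_apply hUm measurableSet_Ioo, map_eq_restrict_of_isUniform hU,
    Measure.restrict_apply measurableSet_Ioo,
    inter_eq_left.2 (Ioo_subset_Ioo ha hb), Real.volume_Ioo, ENNReal.ofReal_eq_zero] at h1
  linarith

theorem measureReal_lt_of_isUniform (hUm : Measurable U)
    (hU : pdf.IsUniform U (Ioo 0 1) P volume) {s : ℝ} (hs : s ∈ Icc (0 : ℝ) 1) :
    P.real {ω | s < U ω} = 1 - s := by
  have h1 : P (U ⁻¹' Ioi s) = ENNReal.ofReal (1 - s) := by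
    rw [← Measure.map_apply hUm measurableSet_Ioi, map_eq_restrict_of_isUniform hU,
      Measure.restrict_apply measurableSet_Ioi, ← Real.volume_Ioo]
    congr 1
    ext x
    simp only [mem_inter_iff, mem_Ioi, mem_Ioo]
    exact ⟨fun h => ⟨h.1, h.2.2⟩, fun h => ⟨h.1, hs.1.trans_lt h.1, h.2⟩⟩
  rw [measureReal_def, show {ω | s < U ω} = U ⁻¹' Ioi s from rfl, h1,
    ENNReal.toReal_ofReal (by linarith [hs.2])]

/-- The measure with density `δ' (U)`. -/
noncomputable def slopeMeasure (P : Measure Ω) (T : ℝ → ℝ) (U : Ω → ℝ) : Measure Ω :=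
  P.withDensity fun ω => ENNReal.ofReal (envelopeSlope T (U ω))

theorem slopeMeasure_absolutelyContinuous : slopeMeasure P T U ≪ P :=
  withDensity_absolutelyContinuous _ _

/-- An event that is upward closed in `U` is an upper level set of `U`, with threshold the
infimum of `U` over the event. -/
theorem exists_threshold (hUm : Measurable U) (hU : pdf.IsUniform U (Ioo 0 1) P volume)
    {G A : Set Ω} (hG : ∀ᵐ ω ∂P, ω ∈ G) (hGU : ∀ ω ∈ G, U ω ∈ Ioo (0 : ℝ) 1)
    (hA : ∀ ω ∈ G, ∀ ω' ∈ G, U ω < U ω' → ω ∈ A → ω' ∈ A) :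
    ∃ s ∈ Icc (0 : ℝ) 1, A =ᵐ[P] {ω | s < U ω} ∧ (∀ ω ∈ G, ω ∈ A → s ≤ U ω) ∧
      (s < 1 → ∀ t, s < t → ∃ ω ∈ G, ω ∈ A ∧ U ω < t) := by
  -- Inserting `1` gives an event without points in `G` the threshold `1`; the approximation claim
  -- is therefore restricted to `s < 1`.
  set V : Set ℝ := insert 1 (U '' (G ∩ A)) with hV
  have hVlb : ∀ x ∈ V, (0 : ℝ) ≤ x := by
    rintro x (rfl | ⟨ω, hω, rfl⟩)
    · exact zero_le_one
    · exact (hGU ω hω.1).1.le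
  have hVb : BddBelow V := ⟨0, hVlb⟩
  have hle : ∀ ω ∈ G, ω ∈ A → sInf V ≤ U ω := fun ω hω hωA =>
    csInf_le hVb (mem_insert_of_mem _ ⟨ω, ⟨hω, hωA⟩, rfl⟩)
  have hex : ∀ t, t ≤ 1 → sInf V < t → ∃ ω ∈ G, ω ∈ A ∧ U ω < t := fun t ht hlt => by
    obtain ⟨x, hx, hxt⟩ := exists_lt_of_csInf_lt (insert_nonempty _ _) hlt
    rcases hx with rfl | ⟨ω, hω, rfl⟩
    · exact absurd hxt ht.not_gt
    · exact ⟨ω, hω.1, hω.2, hxt⟩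
  refine ⟨sInf V, ⟨le_csInf (insert_nonempty _ _) hVlb, csInf_le hVb (mem_insert _ _)⟩, ?_, hle,
    fun hs t hst => ?_⟩
  · filter_upwards [hG, ae_ne_of_isUniform hUm hU (sInf V)] with ω hω hne
    refine propext ⟨fun h => (hle ω hω h).lt_of_ne hne.symm, fun h => ?_⟩
    obtain ⟨ω', hω', hA', hlt⟩ := hex (U ω) (hGU ω hω).2.le h
    exact hA ω' hω' ω hω hlt hA'
  · obtain ⟨ω, hω, hωA, hlt⟩ := hex (min t 1) (min_le_right _ _) (lt_min hst hs)
    exact ⟨ω, hω, hωA, hlt.trans_le (min_le_left _ _)⟩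

variable (hT : IsWeightingFunction T) (hUm : Measurable U)
  (hU : pdf.IsUniform U (Ioo 0 1) P volume)
include hT hUm hU

theorem ae_envelopeSlope_nonneg : ∀ᵐ ω ∂P, 0 ≤ envelopeSlope T (U ω) := by
  filter_upwards [ae_mem_Ioo_of_isUniform hUm hU] with ω hω using hT.envelopeSlope_nonneg hω

theorem integrable_envelopeSlope : Integrable (fun ω => envelopeSlope T (U ω)) P := by
  have h := hT.integrableOn_envelopeSlope
  rw [IntegrableOn, ← map_eq_restrict_of_isUniform hU] at h
  exact h.comp_measurable hUm

theorem integral_slopeMeasure (Z : Ω → ℝ) :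
    ∫ ω, Z ω ∂slopeMeasure P T U = ∫ ω, envelopeSlope T (U ω) * Z ω ∂P := by
  have hm : Measurable fun ω => ENNReal.ofReal (envelopeSlope T (U ω)) :=
    (measurable_envelopeSlope.comp hUm).ennreal_ofReal
  rw [slopeMeasure, integral_withDensity_eq_integral_toReal_smul hm
    (ae_of_all _ fun _ => ENNReal.ofReal_lt_top)]
  refine integral_congr_ae ?_
  filter_upwards [ae_envelopeSlope_nonneg hT hUm hU] with ω hω
  rw [ENNReal.toReal_ofReal hω, smul_eq_mul]

theorem slopeMeasure_lt {s : ℝ} (hs : s ∈ Icc (0 : ℝ) 1) :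
    slopeMeasure P T U {ω | s < U ω} =
      ENNReal.ofReal (1 - convexEnvelope (conjugateDistortion T) s) := by
  rw [slopeMeasure, withDensity_apply _ (measurableSet_lt measurable_const hUm),
    ← ofReal_integral_eq_lintegral_ofReal (integrable_envelopeSlope hT hUm hU).integrableOn
      (ae_restrict_of_ae (ae_envelopeSlope_nonneg hT hUm hU)),
    ← hT.integral_envelopeSlope hs, show {ω | s < U ω} = U ⁻¹' Ioi s from rfl,
    ← setIntegral_map measurableSet_Ioi measurable_envelopeSlope.aestronglyMeasurable
      hUm.aemeasurable, map_eq_restrict_of_isUniform hU,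
    Measure.restrict_restrict measurableSet_Ioi]
  congr 3
  ext x
  simp only [mem_inter_iff, mem_Ioi, mem_Ioo]
  exact ⟨fun h => ⟨h.1, h.2.2⟩, fun h => ⟨h.1, hs.1.trans_lt h.1, h.2⟩⟩

theorem slopeMeasure_real_lt {s : ℝ} (hs : s ∈ Icc (0 : ℝ) 1) :
    (slopeMeasure P T U).real {ω | s < U ω} = 1 - convexEnvelope (conjugateDistortion T) s := by
  rw [measureReal_def, slopeMeasure_lt hT hUm hU hs, ENNReal.toReal_ofReal]
  rw [sub_nonneg]
  refine (convexEnvelope_le hT.conjugateDistortion_nonneg hs).trans ?_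
  rw [conjugateDistortion, sub_le_self_iff]
  exact (hT.mem_Icc ⟨by linarith [hs.2], by linarith [hs.1]⟩).1

/-- The total mass is `δ(1) - δ(0) = 1`. -/
theorem isProbabilityMeasure_slopeMeasure : IsProbabilityMeasure (slopeMeasure P T U) := by
  refine ⟨?_⟩
  have h0 := slopeMeasure_lt hT hUm hU (s := 0) (by simp)
  rw [convexEnvelope_zero hT.conjugateDistortion_nonneg hT.conjugateDistortion_zero, sub_zero,
    ENNReal.ofReal_one] at h0
  rw [← h0]
  refine measure_congr ?_
  filter_upwards [slopeMeasure_absolutelyContinuous.ae_le (ae_mem_Ioo_of_isUniform hUm hU)]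
    with ω hω
  exact propext ⟨fun _ => hω.1, fun _ => trivial⟩

/-- Monotonicity is asked only on a set `s`, because `m_λ⁻¹` is meaningful only on the range of
`m_λ`. -/
theorem aeComonotone_comp_envelopeSlope {q : Ω → ℝ} {r : ℝ → ℝ} {s : Set ℝ}
    (hr : MonotoneOn r s) (hs : ∀ᵐ ω ∂P, envelopeSlope T (U ω) ∈ s)
    (hq : ∀ᵐ ω ∂P, q ω = r (envelopeSlope T (U ω))) : AEComonotone P U q := by
  refine ⟨_, (ae_mem_Ioo_of_isUniform hUm hU).and (hs.and hq), ?_⟩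
  rintro ω ⟨h1, h2, h3⟩ ω' ⟨h1', h2', h3'⟩ hlt
  rw [h3, h3']
  exact hr h2 h2' (hT.monotoneOn_envelopeSlope h1 h1' hlt.le)

/-- Reduces the comparison of the distorted probability with the changed measure to that of `T̃`
with `δ` at the threshold. -/
theorem weight_eq_of_threshold {A : Set Ω} {s : ℝ} (hs : s ∈ Icc (0 : ℝ) 1)
    (hA : A =ᵐ[P] {ω | s < U ω}) :
    T (P.real A) = 1 - conjugateDistortion T s ∧
      (slopeMeasure P T U).real A = 1 - convexEnvelope (conjugateDistortion T) s := by
  rw [measureReal_congr hA, measureReal_lt_of_isUniform hUm hU hs,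
    measureReal_congr (slopeMeasure_absolutelyContinuous.ae_eq hA),
    slopeMeasure_real_lt hT hUm hU hs, conjugateDistortion]
  exact ⟨by ring, rfl⟩

variable [IsProbabilityMeasure P]

/-- The rank-dependent utility is dominated by the expectation under the density `δ' (U)`. -/
theorem choquetIntegral_le_of_aeComonotone {Z : Ω → ℝ} (hZ : MemLp Z ⊤ P)
    (hcom : AEComonotone P U Z) :
    choquetIntegral (fun A => T (P.real A)) Z ≤ ∫ ω, envelopeSlope T (U ω) * Z ω ∂P := by
  have := isProbabilityMeasure_slopeMeasure hT hUm hU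
  obtain ⟨G, hG, hcom⟩ := hcom
  rw [← integral_slopeMeasure hT hUm hU]
  refine hT.choquetIntegral_le slopeMeasure_absolutelyContinuous hZ.1
    (ae_le_lpNorm_exponent_top hZ) fun x => ?_
  obtain ⟨s, hs, hA, -, -⟩ := exists_threshold (A := {ω | x < Z ω}) hUm hU
    (hG.and (ae_mem_Ioo_of_isUniform hUm hU)) (fun ω hω => hω.2)
    (fun ω hω ω' hω' hlt hA => lt_of_lt_of_le hA (hcom ω hω.1 ω' hω'.1 hlt))
  obtain ⟨h1, h2⟩ := weight_eq_of_threshold hT hUm hU hs hA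
  rw [h1, h2]
  exact sub_le_sub_left (convexEnvelope_le hT.conjugateDistortion_nonneg hs) _

/-- For nondecreasing functions of `δ' (U)` the domination is an equality. -/
theorem choquetIntegral_eq_of_aeComonotone {Z : Ω → ℝ} (hZ : MemLp Z ⊤ P)
    (hcom : AEComonotone P U Z) {r : ℝ → ℝ} (hr : ∀ᵐ ω ∂P, Z ω = r (envelopeSlope T (U ω))) :
    choquetIntegral (fun A => T (P.real A)) Z = ∫ ω, envelopeSlope T (U ω) * Z ω ∂P := by
  have := isProbabilityMeasure_slopeMeasure hT hUm hU
  obtain ⟨G, hG, hcom⟩ := hcom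
  rw [← integral_slopeMeasure hT hUm hU, ← choquetIntegral_measureReal (Integrable.of_bound
    (hZ.1.mono_ac slopeMeasure_absolutelyContinuous) _
    (slopeMeasure_absolutelyContinuous.ae_le (ae_le_lpNorm_exponent_top hZ)))]
  have key : ∀ x : ℝ, T (P.real {ω | x < Z ω}) = (slopeMeasure P T U).real {ω | x < Z ω} := by
    intro x
    have hG' := (hG.and (ae_mem_Ioo_of_isUniform hUm hU)).and hr
    obtain ⟨s, hs, hA, hle, hex⟩ := exists_threshold (A := {ω | x < Z ω}) hUm hU hG'
      (fun ω hω => hω.1.2)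
      (fun ω hω ω' hω' hlt hA => lt_of_lt_of_le hA (hcom ω hω.1.1 ω' hω'.1.1 hlt))
    obtain ⟨h1, h2⟩ := weight_eq_of_threshold hT hUm hU hs hA
    rw [h1, h2]
    congr 1
    rcases eq_or_lt_of_le hs.1 with rfl | hs0
    · rw [convexEnvelope_zero hT.conjugateDistortion_nonneg hT.conjugateDistortion_zero,
        hT.conjugateDistortion_zero]
    rcases eq_or_lt_of_le hs.2 with rfl | hs1
    · rw [convexEnvelope_one hT.conjugateDistortion_nonneg hT.continuousOn_conjugateDistortion]
    -- If `δ(s) < T̃(s)`, then `δ'` is constant near `s`. A point of the event with `U` at or just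
    -- above `s` and a point with `U` just below `s` then share the same value of `Z`, so the latter
    -- is in the event too, below its threshold.
    refine (eq_of_le_of_not_lt (convexEnvelope_le hT.conjugateDistortion_nonneg hs)
      fun hlt => ?_).symm
    obtain ⟨k, hk⟩ := eventually_deriv_convexEnvelope_eq hT.conjugateDistortion_nonneg
      hT.conjugateDistortion_zero hT.continuousOn_conjugateDistortion ⟨hs0, hs1⟩ hlt
    obtain ⟨a, b, hab, hsub⟩ := mem_nhds_iff_exists_Ioo_subset.1 hk
    obtain ⟨ω, hω, hωA, hωb⟩ := hex hs1 b hab.2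
    obtain ⟨ω', hω', hU'⟩ := exists_mem_Ioo_of_isUniform hUm hU hG'
      (le_max_right a 0) (max_lt hab.1 hs0) hs.2
    have h3 : envelopeSlope T (U ω) = k := hsub ⟨hab.1.trans_le (hle ω hω hωA), hωb⟩
    have h4 : envelopeSlope T (U ω') = k :=
      hsub ⟨(le_max_left _ _).trans_lt hU'.1, hU'.2.trans hab.2⟩
    have h5 : x < Z ω' := by
      rw [hω'.2, h4, ← h3, ← hω.2]
      exact hωA
    exact (hle ω' hω' h5).not_gt hU'.2
  simp only [choquetIntegral, key, probReal_univ, hT.map_one]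

end Density

/-! ### Welfare -/

section Welfare

variable {Ω : Type*} [MeasurableSpace Ω] {P : Measure Ω}

theorem memLp_top_continuous_comp {f : Ω → ℝ} (hf : MemLp f ⊤ P) {g : ℝ → ℝ}
    (hg : Continuous g) : MemLp (fun ω => g (f ω)) ⊤ P := by
  set c := lpNorm f ⊤ P
  obtain ⟨C, hC⟩ := (isCompact_Icc (a := -c) (b := c)).exists_bound_of_continuousOn hg.continuousOn
  refine memLp_top_of_bound (hg.comp_aestronglyMeasurable hf.1) C ?_
  filter_upwards [ae_le_lpNorm_exponent_top hf] with ω hω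
  exact hC _ (abs_le.1 hω)

theorem ae_sum_succ_eq {N : ℕ} {w : ℝ} {X : Fin (N + 1) → Ω → ℝ}
    (hX : X ∈ feasibleAllocations P N w) : ∀ᵐ ω ∂P, ∑ i : Fin N, X i.succ ω = w - X 0 ω := by
  filter_upwards [hX.2] with ω hω
  rw [Fin.sum_univ_succ] at hω
  linarith

theorem integrable_slope_mul_utility {T : ℝ → ℝ} {v : ℝ → ℝ} {U q : Ω → ℝ}
    (hT : IsWeightingFunction T) (hv : IsUtilityFunction v) (hUm : Measurable U)
    (hU : pdf.IsUniform U (Ioo 0 1) P volume) (hq : MemLp q ⊤ P) :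
    Integrable (fun ω => envelopeSlope T (U ω) * v (q ω)) P :=
  have h := memLp_top_continuous_comp hq hv.differentiable.continuous
  (integrable_envelopeSlope hT hUm hU).mul_bdd h.1 (ae_le_lpNorm_exponent_top h)

variable [IsProbabilityMeasure P] {N : ℕ} {T : ℝ → ℝ} {u : Fin (N + 1) → ℝ → ℝ} {lam : Fin N → ℝ}
  {w : ℝ} {X Y : Fin (N + 1) → Ω → ℝ}

theorem integrable_utility (hu : ∀ i, IsUtilityFunction (u i))
    (hX : X ∈ feasibleAllocations P N w) (i : Fin (N + 1)) :
    Integrable (fun ω => u i (X i ω)) P :=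
  (memLp_top_continuous_comp (hX.1 i) (hu i).differentiable.continuous).integrable le_top

theorem integrable_sum_utility (hu : ∀ i, IsUtilityFunction (u i))
    (hX : X ∈ feasibleAllocations P N w) :
    Integrable (fun ω => ∑ i : Fin N, lam i * u i.succ (X i.succ ω)) P :=
  integrable_finsetSum _ fun i _ => (integrable_utility hu hX i.succ).const_mul (lam i)

theorem welfare_eq (hu : ∀ i, IsUtilityFunction (u i)) (hX : X ∈ feasibleAllocations P N w) :
    welfare P T u lam X = rankDependentUtility P T (u 0) (X 0) +
      ∫ ω, ∑ i : Fin N, lam i * u i.succ (X i.succ ω) ∂P := by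
  rw [welfare, integral_finsetSum _ fun i _ => (integrable_utility hu hX i.succ).const_mul (lam i)]
  simp only [expectedUtility, integral_const_mul]

/-! #### Efficient sharing among the EU agents -/

/-- With the first coordinate fixed, the Choquet term cancels, and optimality excludes a strict gain
for the EU agents on a set of positive measure. -/
theorem IsWelfareOptimal.ae_eq_of_le (hu : ∀ i, IsUtilityFunction (u i))
    (hX : IsWelfareOptimal P T u lam w X) (hY : Y ∈ feasibleAllocations P N w) (h0 : Y 0 = X 0)
    (hle : ∀ᵐ ω ∂P, ∑ i : Fin N, lam i * u i.succ (X i.succ ω) ≤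
      ∑ i : Fin N, lam i * u i.succ (Y i.succ ω)) :
    ∀ᵐ ω ∂P, ∑ i : Fin N, lam i * u i.succ (X i.succ ω) =
      ∑ i : Fin N, lam i * u i.succ (Y i.succ ω) := by
  have h1 := hX.2 Y hY
  rw [welfare_eq hu hX.1, welfare_eq hu hY, h0, add_le_add_iff_left] at h1
  exact (integral_eq_iff_of_ae_le (integrable_sum_utility hu hX.1)
    (integrable_sum_utility hu hY) hle).1 (le_antisymm
      (integral_mono_ae (integrable_sum_utility hu hX.1) (integrable_sum_utility hu hY) hle) h1)

/-- No transfer of size `ε` between two EU agents is profitable. -/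
theorem IsWelfareOptimal.ae_marginal_le_of_pos (hu : ∀ i, IsUtilityFunction (u i))
    (hlam : ∀ i, 0 < lam i) (hX : IsWelfareOptimal P T u lam w X) {i j : Fin N} (hij : i ≠ j)
    {ε : ℝ} (hε : 0 < ε) :
    ∀ᵐ ω ∂P, lam i * deriv (u i.succ) (X i.succ ω + ε) -
      lam j * deriv (u j.succ) (X j.succ ω - ε) ≤ 0 := by
  set g : Ω → ℝ := fun ω => lam i * deriv (u i.succ) (X i.succ ω + ε) -
      lam j * deriv (u j.succ) (X j.succ ω - ε) with hg
  -- Transfer `ε` from `j` to `i` only where the marginal comparison still favours `i` after the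
  -- transfer. Tangents at the new positions then bound the gain below by `ε * g > 0`.
  set z : Ω → ℝ := fun ω => if 0 < g ω then ε else 0 with hz
  have hgm : AEMeasurable g P := by
    have hc : ∀ k, Continuous (deriv (u k)) := fun k => (hu k).continuous_deriv
    have hm : ∀ k, AEMeasurable (X k) P := fun k => (hX.1.1 k).1.aemeasurable
    exact (((hc _).measurable.comp_aemeasurable ((hm _).add_const ε)).const_mul _).sub
      (((hc _).measurable.comp_aemeasurable ((hm _).sub_const ε)).const_mul _)
  have hzm : MemLp z ⊤ P := by
    have hstep : Measurable fun x : ℝ => if 0 < x then ε else 0 :=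
      Measurable.ite measurableSet_Ioi measurable_const measurable_const
    refine memLp_top_of_bound (hstep.comp_aemeasurable hgm).aestronglyMeasurable ε
      (ae_of_all _ fun ω => ?_)
    simp only [hz]
    split_ifs <;> simp [abs_of_pos hε, hε.le]
  set Y : Fin (N + 1) → Ω → ℝ := Fin.cons (X 0) fun k ω =>
    X k.succ ω + ((if k = i then z ω else 0) - if k = j then z ω else 0) with hY
  have hYf : Y ∈ feasibleAllocations P N w := by
    refine ⟨fun k => ?_, ?_⟩
    · refine Fin.cases (hX.1.1 0) (fun k => ?_) k
      change MemLp (fun ω => X k.succ ω +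
        ((if k = i then z ω else 0) - if k = j then z ω else 0)) ⊤ P
      refine (hX.1.1 k.succ).add (MemLp.sub ?_ ?_) <;> split_ifs <;> first | exact hzm | simp
    · filter_upwards [hX.1.2] with ω hω
      rw [Fin.sum_univ_succ] at hω ⊢
      simp only [hY, Fin.cons_zero, Fin.cons_succ, Finset.sum_add_distrib, Finset.sum_sub_distrib,
        Finset.sum_ite_eq', Finset.mem_univ, if_true, sub_self, add_zero]
      exact hω
  have hdiff : ∀ ω, ∑ k : Fin N, lam k * u k.succ (Y k.succ ω) -
      ∑ k : Fin N, lam k * u k.succ (X k.succ ω) =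
      (lam i * u i.succ (X i.succ ω + z ω) - lam i * u i.succ (X i.succ ω)) +
      (lam j * u j.succ (X j.succ ω - z ω) - lam j * u j.succ (X j.succ ω)) := fun ω => by
    rw [← Finset.sum_sub_distrib, Fintype.sum_eq_add i j hij]
    · simp [hY, hij, hij.symm, sub_eq_add_neg]
    · rintro k ⟨hki, hkj⟩
      simp [hY, hki, hkj]
  have hgain : ∀ ω, 0 < g ω → ∑ k : Fin N, lam k * u k.succ (X k.succ ω) <
      ∑ k : Fin N, lam k * u k.succ (Y k.succ ω) := fun ω hω => by
    rw [← sub_pos, hdiff ω, show z ω = ε from if_pos hω]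
    have h1 := mul_le_mul_of_nonneg_left
      ((hu i.succ).le_tangent (X i.succ ω + ε) (X i.succ ω)) (hlam i).le
    have h2 := mul_le_mul_of_nonneg_left
      ((hu j.succ).le_tangent (X j.succ ω - ε) (X j.succ ω)) (hlam j).le
    have h3 := mul_pos hε hω
    simp only [hg] at h3
    nlinarith
  have hle : ∀ ω, ∑ k : Fin N, lam k * u k.succ (X k.succ ω) ≤
      ∑ k : Fin N, lam k * u k.succ (Y k.succ ω) := fun ω => by
    by_cases hω : 0 < g ω
    · exact (hgain ω hω).le
    · rw [← sub_nonneg, hdiff ω, show z ω = 0 from if_neg hω]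
      simp
  filter_upwards [hX.ae_eq_of_le hu hYf rfl (ae_of_all _ hle)] with ω hω
  by_contra! hpos
  exact (hgain ω hpos).ne hω

theorem IsWelfareOptimal.ae_marginal_le (hu : ∀ i, IsUtilityFunction (u i))
    (hlam : ∀ i, 0 < lam i) (hX : IsWelfareOptimal P T u lam w X) (i j : Fin N) :
    ∀ᵐ ω ∂P, lam i * deriv (u i.succ) (X i.succ ω) ≤ lam j * deriv (u j.succ) (X j.succ ω) := by
  rcases eq_or_ne i j with rfl | hij
  · exact ae_of_all _ fun ω => le_rfl
  have h : ∀ᵐ ω ∂P, ∀ n : ℕ, lam i * deriv (u i.succ) (X i.succ ω + 1 / ((n : ℝ) + 1)) -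
      lam j * deriv (u j.succ) (X j.succ ω - 1 / ((n : ℝ) + 1)) ≤ 0 :=
    ae_all_iff.2 fun n => hX.ae_marginal_le_of_pos hu hlam hij Nat.one_div_pos_of_nat
  filter_upwards [h] with ω hω
  have hc : Continuous fun ε => lam i * deriv (u i.succ) (X i.succ ω + ε) -
      lam j * deriv (u j.succ) (X j.succ ω - ε) :=
    (((hu _).continuous_deriv.comp (continuous_const.add continuous_id)).const_mul _).sub
      (((hu _).continuous_deriv.comp (continuous_const.sub continuous_id)).const_mul _)
  have hlim := (hc.tendsto 0).comp (tendsto_one_div_add_atTop_nhds_zero_nat (𝕜 := ℝ))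
  have := le_of_tendsto' hlim hω
  simp only [add_zero, sub_zero] at this
  linarith

theorem IsWelfareOptimal.ae_mem_aggregateDomain [NeZero N] (hu : ∀ i, IsUtilityFunction (u i))
    (hlam : ∀ i, 0 < lam i) (hX : IsWelfareOptimal P T u lam w X) :
    ∀ᵐ ω ∂P, ∃ y ∈ aggregateDomain (fun i : Fin N => u i.succ) lam,
      ∀ i, lam i * deriv (u i.succ) (X i.succ ω) = y := by
  have h : ∀ᵐ ω ∂P, ∀ i j, lam i * deriv (u i.succ) (X i.succ ω) ≤
      lam j * deriv (u j.succ) (X j.succ ω) :=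
    ae_all_iff.2 fun i => ae_all_iff.2 fun j => hX.ae_marginal_le hu hlam i j
  filter_upwards [h] with ω hω
  have heq : ∀ i, lam i * deriv (u i.succ) (X i.succ ω) =
      lam 0 * deriv (u (Fin.succ 0)) (X (Fin.succ 0) ω) := fun i => le_antisymm (hω i 0) (hω 0 i)
  exact ⟨_, mem_aggregateDomain (x := fun i => X i.succ ω) hlam heq, heq⟩

theorem IsWelfareOptimal.aggregateDomain_nonempty [NeZero N]
    (hu : ∀ i, IsUtilityFunction (u i)) (hlam : ∀ i, 0 < lam i)
    (hX : IsWelfareOptimal P T u lam w X) :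
    (aggregateDomain (fun i : Fin N => u i.succ) lam).Nonempty :=
  let ⟨_, y, hy, _⟩ := (hX.ae_mem_aggregateDomain hu hlam).exists
  ⟨y, hy⟩

/-- The common price `y` satisfies `I_λ(y) = w - X_1` by feasibility, so it must be `J_λ(w - X_1)`.
-/
theorem IsWelfareOptimal.ae_eq_optimalShare [NeZero N] (hu : ∀ i, IsUtilityFunction (u i))
    (hlam : ∀ i, 0 < lam i) (hX : IsWelfareOptimal P T u lam w X) :
    ∀ᵐ ω ∂P, ∀ i, X i.succ ω = optimalShare (fun i : Fin N => u i.succ) lam i (w - X 0 ω) := by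
  filter_upwards [hX.ae_mem_aggregateDomain hu hlam, ae_sum_succ_eq hX.1] with ω ⟨y, hy, h⟩ hsum i
  have hI : ∀ i, inverseMarginal (u i.succ) (y / lam i) = X i.succ ω := fun i =>
    inverseMarginal_div_eq (v := fun i : Fin N => u i.succ) (fun i => hu i.succ) hlam (h i)
  have hJ := aggregateMarginal_aggregateInverse (v := fun i : Fin N => u i.succ)
    (fun i => hu i.succ) hlam hy
  rw [aggregateInverse, Finset.sum_congr rfl fun i _ => hI i, hsum] at hJ
  rw [optimalShare, hJ, hI]

/-! #### Reduction to the allocation of the RDU agent -/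

section Reduction

variable [NeZero N] {U : Ω → ℝ} (hT : IsWeightingFunction T)
  (hu : ∀ i, IsUtilityFunction (u i)) (hlam : ∀ i, 0 < lam i)
  (hD : (aggregateDomain (fun i : Fin N => u i.succ) lam).Nonempty)
  (hUm : Measurable U) (hU : pdf.IsUniform U (Ioo 0 1) P volume)

/-- The integrand of the reduced problem, at the slope `s` and the allocation `q`. -/
noncomputable def reducedObjective (u : Fin (N + 1) → ℝ → ℝ) (lam : Fin N → ℝ) (w s q : ℝ) : ℝ :=
  s * u 0 q + aggregateUtility (fun i : Fin N => u i.succ) lam (w - q)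

include hu hlam hD in
theorem continuous_aggregateUtility :
    Continuous (aggregateUtility (fun i : Fin N => u i.succ) lam) :=
  continuous_iff_continuousAt.2 fun x =>
    (hasDerivAt_aggregateUtility (fun i => hu i.succ) hlam hD x).continuousAt

include hu hlam hD in
theorem integrable_aggregateUtility {q : Ω → ℝ} (hq : MemLp q ⊤ P) :
    Integrable (fun ω => aggregateUtility (fun i : Fin N => u i.succ) lam (w - q ω)) P :=
  (memLp_top_continuous_comp hq
    ((continuous_aggregateUtility hu hlam hD).comp (continuous_sub_left w))).integrable le_top

include hT hu hlam hD hUm hU in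
theorem integrable_reducedObjective {q : Ω → ℝ} (hq : MemLp q ⊤ P) :
    Integrable (fun ω => reducedObjective u lam w (envelopeSlope T (U ω)) (q ω)) P :=
  (integrable_slope_mul_utility hT (hu 0) hUm hU hq).add (integrable_aggregateUtility hu hlam hD hq)

include hT hu hlam hD hUm hU in
theorem welfare_le_integral_reducedObjective (hY : Y ∈ feasibleAllocations P N w)
    (hcom : AEComonotone P U (Y 0)) :
    welfare P T u lam Y ≤
      ∫ ω, reducedObjective u lam w (envelopeSlope T (U ω)) (Y 0 ω) ∂P := by
  simp only [reducedObjective]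
  rw [welfare_eq hu hY, integral_add (integrable_slope_mul_utility hT (hu 0) hUm hU (hY.1 0))
    (integrable_aggregateUtility hu hlam hD (hY.1 0))]
  refine add_le_add ?_ (integral_mono_ae (integrable_sum_utility hu hY)
    (integrable_aggregateUtility hu hlam hD (hY.1 0)) ?_)
  · exact choquetIntegral_le_of_aeComonotone hT hUm hU
      (memLp_top_continuous_comp (hY.1 0) (hu 0).differentiable.continuous)
      (hcom.comp (hu 0).monotone)
  · filter_upwards [ae_sum_succ_eq hY] with ω hω
    have h := sum_le_aggregateUtility (v := fun i : Fin N => u i.succ) (fun i => hu i.succ) hlam hD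
      (w - Y 0 ω) fun i => Y i.succ ω
    rwa [hω, sub_self, mul_zero, add_zero] at h

include hT hu hUm hU hlam hD in
theorem welfare_eq_integral_reducedObjective (hY : Y ∈ feasibleAllocations P N w)
    (hcom : AEComonotone P U (Y 0)) {r : ℝ → ℝ}
    (hr : ∀ᵐ ω ∂P, Y 0 ω = r (envelopeSlope T (U ω)))
    (hshare : ∀ᵐ ω ∂P, ∀ i : Fin N,
      Y i.succ ω = optimalShare (fun i : Fin N => u i.succ) lam i (w - Y 0 ω)) :
    welfare P T u lam Y =
      ∫ ω, reducedObjective u lam w (envelopeSlope T (U ω)) (Y 0 ω) ∂P := by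
  simp only [reducedObjective]
  rw [welfare_eq hu hY, integral_add (integrable_slope_mul_utility hT (hu 0) hUm hU (hY.1 0))
    (integrable_aggregateUtility hu hlam hD (hY.1 0))]
  congr 1
  · refine choquetIntegral_eq_of_aeComonotone hT hUm hU
      (memLp_top_continuous_comp (hY.1 0) (hu 0).differentiable.continuous)
      (hcom.comp (hu 0).monotone) (r := fun s => u 0 (r s)) ?_
    filter_upwards [hr] with ω hω
    rw [hω]
  · refine integral_congr_ae ?_
    filter_upwards [hshare] with ω hω
    rw [aggregateUtility_eq]
    exact Finset.sum_congr rfl fun i _ => by rw [hω i]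

end Reduction

end Welfare

/-! ### Characterization of the optimum -/

section Main

variable {Ω : Type*} [MeasurableSpace Ω] {P : Measure Ω}
  {N : ℕ} [NeZero N] {T : ℝ → ℝ} {u : Fin (N + 1) → ℝ → ℝ} {lam : Fin N → ℝ}
  {w : ℝ} {X : Fin (N + 1) → Ω → ℝ}

theorem optimalShare_mem_feasibleAllocations (hu : ∀ i, IsUtilityFunction (u i))
    (hlam : ∀ i, 0 < lam i) (hD : (aggregateDomain (fun i : Fin N => u i.succ) lam).Nonempty)
    {q : Ω → ℝ} (hq : MemLp q ⊤ P) :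
    (Fin.cons q fun i ω => optimalShare (fun i : Fin N => u i.succ) lam i (w - q ω) :
      Fin (N + 1) → Ω → ℝ) ∈ feasibleAllocations P N w := by
  refine ⟨fun i => ?_, ae_of_all _ fun ω => ?_⟩
  · refine Fin.cases hq (fun i => ?_) i
    exact memLp_top_continuous_comp hq
      ((continuous_optimalShare (fun i => hu i.succ) hlam hD i).comp (continuous_sub_left w))
  · rw [Fin.sum_univ_succ]
    simp only [Fin.cons_zero, Fin.cons_succ]
    rw [sum_optimalShare (fun i => hu i.succ) hlam hD]
    ring

variable [IsProbabilityMeasure P]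

/-- The marginal ratio has a monotone inverse on each interval, whose values are the constrained
maximizers of the reduced objective. -/
theorem exists_constrained_maximizer (hu : ∀ i, IsUtilityFunction (u i))
    (hlam : ∀ i, 0 < lam i) (hD : (aggregateDomain (fun i : Fin N => u i.succ) lam).Nonempty)
    {k : ℝ} (hk : 0 ≤ k) :
    ∃ r : ℝ → ℝ, Monotone r ∧ (∀ s, |r s| ≤ k) ∧
      (∀ s, |r s| < k → marginalRatio (u 0) (fun i : Fin N => u i.succ) lam w (r s) = s) ∧
      ∀ s, 0 ≤ s → ∀ q, |q| ≤ k → q ≠ r s →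
        reducedObjective u lam w s q < reducedObjective u lam w s (r s) := by
  set m := marginalRatio (u 0) (fun i : Fin N => u i.succ) lam w with hm
  have hmono : StrictMono m := strictMono_marginalRatio (hu 0) (fun i => hu i.succ) hlam hD
  have hcont : Continuous m := continuous_marginalRatio (hu 0) (fun i => hu i.succ) hlam hD
  have hkk : m (-k) ≤ m k := hmono.monotone (by linarith)
  -- The slope is clamped to `[m (-k), m k]` before `m` is inverted, so `r` is defined even for `s`
  -- outside the range of `m`.
  have hex : ∀ s, ∃ a, m a = max (m (-k)) (min (m k) s) := fun s =>
    mem_range_of_exists_le_of_exists_ge hcont ⟨-k, le_max_left _ _⟩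
      ⟨k, max_le hkk (min_le_left _ _)⟩
  choose r hr using hex
  have hlow : ∀ s, -k ≤ r s := fun s => hmono.le_iff_le.1 (by rw [hr]; exact le_max_left _ _)
  have hup : ∀ s, r s ≤ k := fun s =>
    hmono.le_iff_le.1 (by rw [hr]; exact max_le hkk (min_le_left _ _))
  refine ⟨r, fun s t hst => hmono.le_iff_le.1 ?_, fun s => abs_le.2 ⟨hlow s, hup s⟩,
    fun s hs => ?_, fun s hs q hq hne => ?_⟩
  · rw [hr, hr]
    exact max_le_max_left _ (min_le_min_left _ hst)
  · have h1 : m (-k) < m (r s) := hmono (abs_lt.1 hs).1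
    have h2 : m (r s) < m k := hmono (abs_lt.1 hs).2
    rw [hr] at h1 h2 ⊢
    rcases lt_max_iff.1 h1 with h | h
    · exact absurd h (lt_irrefl _)
    rw [max_eq_right h.le] at h2 ⊢
    rcases min_lt_iff.1 h2 with h' | h'
    · exact absurd h' (lt_irrefl _)
    · exact min_eq_right h'.le
  · refine objective_lt (hu 0) (fun i => hu i.succ) hlam hD hs hne ?_
    obtain ⟨hq1, hq2⟩ := abs_le.1 hq
    rw [← hm]
    rcases le_or_gt s (m k) with h1 | h1
    · rcases le_or_gt (m (-k)) s with h2 | h2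
      · rw [hr, min_eq_right h1, max_eq_right h2, sub_self, zero_mul]
      · have h3 : m (r s) = m (-k) := by rw [hr, min_eq_right h1, max_eq_left h2.le]
        rw [h3, hmono.injective h3]
        exact mul_nonpos_of_nonpos_of_nonneg (by linarith) (by linarith)
    · have h3 : m (r s) = m k := by rw [hr, min_eq_left h1.le, max_eq_right hkk]
      rw [h3, hmono.injective h3]
      exact mul_nonpos_of_nonneg_of_nonpos (by linarith) (by linarith)

/-- Take `U` comonotone with `X_1` and compare with the constrained maximizer `q = r(δ'(U))`, which
is bounded and hence feasible although `m_λ⁻¹(δ'(U))` might not be. The welfare of `X` is at most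
its reduced integral, which is at most that of `q`, a welfare actually attained. Optimality makes
all of these equal, and uniqueness gives `X_1 = q`. -/
theorem IsWelfareOptimal.exists_uniform (hP : IsNonatomic P) (hT : IsWeightingFunction T)
    (hu : ∀ i, IsUtilityFunction (u i)) (hlam : ∀ i, 0 < lam i)
    (hX : IsWelfareOptimal P T u lam w X) :
    ∃ U : Ω → ℝ, pdf.IsUniform U (Ioo 0 1) P volume ∧ ∀ᵐ ω ∂P,
      marginalRatio (u 0) (fun i : Fin N => u i.succ) lam w (X 0 ω) = envelopeSlope T (U ω) := by
  have hD := hX.aggregateDomain_nonempty hu hlam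
  have hX0 : MemLp (X 0) ⊤ P := hX.1.1 0
  obtain ⟨U, hUm, hU, hcom⟩ := exists_uniform_aeComonotone hP hX0.1.aemeasurable
  have hbound := ae_le_lpNorm_exponent_top hX0
  set C := lpNorm (X 0) ⊤ P with hC
  have hC0 : 0 ≤ C := lpNorm_nonneg
  -- The bound `C + 1` leaves room: `|X_1| ≤ C` a.s., so once `X_1 = q` the constraint is slack and
  -- the first order condition holds exactly.
  obtain ⟨r, hrmono, hrle, hrint, hrmax⟩ := exists_constrained_maximizer (w := w) hu hlam hD
    (show 0 ≤ C + 1 by linarith)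
  set q : Ω → ℝ := fun ω => r (envelopeSlope T (U ω)) with hq
  have hqm : MemLp q ⊤ P := memLp_top_of_bound
    ((hrmono.measurable.comp measurable_envelopeSlope).comp hUm).aestronglyMeasurable (C + 1)
    (ae_of_all _ fun ω => hrle _)
  have hY := optimalShare_mem_feasibleAllocations (w := w) hu hlam hD hqm
  set Y : Fin (N + 1) → Ω → ℝ := Fin.cons q fun i ω =>
    optimalShare (fun i : Fin N => u i.succ) lam i (w - q ω)
  have hwY : welfare P T u lam Y =
      ∫ ω, reducedObjective u lam w (envelopeSlope T (U ω)) (q ω) ∂P :=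
    welfare_eq_integral_reducedObjective hT hu hlam hD hUm hU hY
      (aeComonotone_comp_envelopeSlope (s := univ) hT hUm hU (hrmono.monotoneOn _)
        (ae_of_all _ fun _ => trivial) (ae_of_all _ fun _ => rfl))
      (r := r) (ae_of_all _ fun _ => rfl) (ae_of_all _ fun _ _ => rfl)
  have hwX := welfare_le_integral_reducedObjective hT hu hlam hD hUm hU hX.1 hcom
  have hiX := integrable_reducedObjective (w := w) hT hu hlam hD hUm hU hX0
  have hiY := integrable_reducedObjective (w := w) hT hu hlam hD hUm hU hqm
  have hlt : ∀ᵐ ω ∂P, X 0 ω ≠ q ω →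
      reducedObjective u lam w (envelopeSlope T (U ω)) (X 0 ω) <
        reducedObjective u lam w (envelopeSlope T (U ω)) (q ω) := by
    filter_upwards [hbound, ae_envelopeSlope_nonneg hT hUm hU] with ω h1 h2 hne
    exact hrmax _ h2 _ (by rw [← Real.norm_eq_abs]; linarith) hne
  have hle : (fun ω => reducedObjective u lam w (envelopeSlope T (U ω)) (X 0 ω)) ≤ᵐ[P]
      fun ω => reducedObjective u lam w (envelopeSlope T (U ω)) (q ω) := by
    filter_upwards [hlt] with ω hω
    by_cases h : X 0 ω = q ω
    · rw [h]
    · exact (hω h).le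
  have heq := (integral_eq_iff_of_ae_le hiX hiY hle).1 (le_antisymm (integral_mono_ae hiX hiY hle)
    (hwY.symm.trans_le ((hX.2 Y hY).trans hwX)))
  refine ⟨U, hU, ?_⟩
  filter_upwards [hlt, heq, hbound] with ω h1 h2 h3
  have h4 : X 0 ω = q ω := by
    by_contra hne
    exact (h1 hne).ne h2
  rw [h4] at h3 ⊢
  refine hrint _ ?_
  rw [← Real.norm_eq_abs]
  exact h3.trans_lt (lt_add_one C)

theorem isWelfareOptimal_of_measurable (hP : IsNonatomic P) (hT : IsWeightingFunction T)
    (hu : ∀ i, IsUtilityFunction (u i)) (hlam : ∀ i, 0 < lam i)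
    (hX : X ∈ feasibleAllocations P N w)
    (hD : (aggregateDomain (fun i : Fin N => u i.succ) lam).Nonempty)
    {U : Ω → ℝ} (hUm : Measurable U) (hU : pdf.IsUniform U (Ioo 0 1) P volume)
    (hXU : ∀ᵐ ω ∂P,
      marginalRatio (u 0) (fun i : Fin N => u i.succ) lam w (X 0 ω) = envelopeSlope T (U ω))
    (hshare : ∀ᵐ ω ∂P, ∀ i : Fin N,
      X i.succ ω = optimalShare (fun i : Fin N => u i.succ) lam i (w - X 0 ω)) :
    IsWelfareOptimal P T u lam w X := by
  set m := marginalRatio (u 0) (fun i : Fin N => u i.succ) lam w with hm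
  have hmono : StrictMono m := strictMono_marginalRatio (hu 0) (fun i => hu i.succ) hlam hD
  have hcont : Continuous m := continuous_marginalRatio (hu 0) (fun i => hu i.succ) hlam hD
  have hemb : MeasurableEmbedding m := hcont.measurableEmbedding hmono.injective
  -- `r` is `m⁻¹` on the range of `m`, extended measurably to `ℝ` so that it can be composed with
  -- laws.
  obtain ⟨r, hrm, hr⟩ := hemb.exists_measurable_extend measurable_id fun _ => ⟨(0 : ℝ)⟩
  have hrm' : ∀ x, r (m x) = x := congrFun hr
  have hrmono : MonotoneOn r (range m) := by
    rintro _ ⟨x, rfl⟩ _ ⟨y, rfl⟩ hxy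
    rw [hrm', hrm']
    exact hmono.le_iff_le.1 hxy
  have hXr : ∀ᵐ ω ∂P, X 0 ω = r (envelopeSlope T (U ω)) := by
    filter_upwards [hXU] with ω hω
    rw [← hω, hrm']
  have hrange : ∀ᵐ ω ∂P, envelopeSlope T (U ω) ∈ range m := by
    filter_upwards [hXU] with ω hω using ⟨_, hω⟩
  have hwX := welfare_eq_integral_reducedObjective hT hu hlam hD hUm hU hX
    (aeComonotone_comp_envelopeSlope hT hUm hU hrmono hrange hXr) hXr hshare
  have hobj : Measurable fun s => reducedObjective u lam w s (r s) :=
    (measurable_id.mul ((hu 0).differentiable.continuous.measurable.comp hrm)).add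
      ((continuous_aggregateUtility hu hlam hD).measurable.comp (measurable_const.sub hrm))
  have hae : (fun ω => reducedObjective u lam w (envelopeSlope T (U ω)) (X 0 ω)) =ᵐ[P]
      fun ω => reducedObjective u lam w (envelopeSlope T (U ω)) (r (envelopeSlope T (U ω))) := by
    filter_upwards [hXr] with ω hω
    rw [hω]
  rw [integral_congr_ae hae] at hwX
  have hint := (integrable_reducedObjective (w := w) hT hu hlam hD hUm hU (hX.1 0)).congr hae
  refine ⟨hX, fun Y hY => ?_⟩
  -- The competitor needs its own uniform variable. Equality in law transfers both the range
  -- condition and the value of the maximized integral from `U` to `V`.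
  obtain ⟨V, hVm, hV, hcom⟩ := exists_uniform_aeComonotone hP (hY.1 0).1.aemeasurable
  have hUV : ProbabilityTheory.IdentDistrib (fun ω => envelopeSlope T (U ω))
      (fun ω => envelopeSlope T (V ω)) P P :=
    (⟨hUm.aemeasurable, hVm.aemeasurable, hU.trans hV.symm⟩ :
      ProbabilityTheory.IdentDistrib U V P P).comp measurable_envelopeSlope
  have hUV' := hUV.comp hobj
  have hrangeV : ∀ᵐ ω ∂P, envelopeSlope T (V ω) ∈ range m :=
    hUV.ae_mem_snd hemb.measurableSet_range hrange
  have hintV : Integrable (fun ω => reducedObjective u lam w (envelopeSlope T (V ω))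
      (r (envelopeSlope T (V ω)))) P := hUV'.integrable_iff.1 hint
  calc welfare P T u lam Y
      ≤ ∫ ω, reducedObjective u lam w (envelopeSlope T (V ω)) (Y 0 ω) ∂P :=
        welfare_le_integral_reducedObjective hT hu hlam hD hVm hV hY hcom
    _ ≤ ∫ ω, reducedObjective u lam w (envelopeSlope T (V ω)) (r (envelopeSlope T (V ω))) ∂P := by
        refine integral_mono_ae
          (integrable_reducedObjective hT hu hlam hD hVm hV (hY.1 0)) hintV ?_
        filter_upwards [hrangeV] with ω ⟨a, ha⟩
        rw [← ha, hrm']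
        rcases eq_or_ne (Y 0 ω) a with h | h
        · rw [h]
        · refine (objective_lt (hu 0) (fun i => hu i.succ) hlam hD
            (marginalRatio_pos (hu 0) (fun i => hu i.succ) hlam hD a).le h ?_).le
          rw [← hm, sub_self, zero_mul]
    _ = welfare P T u lam X := by rw [hwX]; exact hUV'.integral_eq.symm

end Main

theorem theorem3p6 {Ω : Type*} [MeasurableSpace Ω] (P : Measure Ω) [IsProbabilityMeasure P]
    (hP : IsNonatomic P)
    (N : ℕ) (hN : 1 ≤ N)
    (T : ℝ → ℝ) (hT : IsWeightingFunction T)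
    (u : Fin (N + 1) → ℝ → ℝ) (hu : ∀ i, IsUtilityFunction (u i))
    (lam : Fin N → ℝ) (hlam : ∀ i, 0 < lam i)
    (w : ℝ) (X : Fin (N + 1) → Ω → ℝ) (hX : X ∈ feasibleAllocations P N w) :
    IsWelfareOptimal P T u lam w X ↔
      -- the functions `I_λ`, `J_λ`, `u_λ` and `m_λ` are defined
      (aggregateDomain (fun i : Fin N => u i.succ) lam).Nonempty ∧
      (∃ U : Ω → ℝ, pdf.IsUniform U (Ioo 0 1) P volume ∧
        -- the value `m_λ⁻¹ (δ' (U))` is defined, and `X_1` is equal to it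
        (∀ᵐ ω ∂P, deriv (convexEnvelope (conjugateDistortion T)) (U ω) ∈
          range (marginalRatio (u 0) (fun i : Fin N => u i.succ) lam w)) ∧
        ∀ᵐ ω ∂P, X 0 ω =
          Function.invFun (marginalRatio (u 0) (fun i : Fin N => u i.succ) lam w)
            (deriv (convexEnvelope (conjugateDistortion T)) (U ω))) ∧
      ∀ i : Fin N, ∀ᵐ ω ∂P, X i.succ ω =
        inverseMarginal (u i.succ)
          ((lam i)⁻¹ * aggregateMarginal (fun i : Fin N => u i.succ) lam (w - X 0 ω)) := by
  -- `N` counts only the EU agents, so `n ≥ 2` is `N ≥ 1`.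
  have : NeZero N := ⟨by omega⟩
  simp only [inv_mul_eq_div]
  constructor
  · intro hopt
    have hD := hopt.aggregateDomain_nonempty hu hlam
    obtain ⟨U, hU, hXU⟩ := hopt.exists_uniform hP hT hu hlam
    refine ⟨hD, ⟨U, hU, ?_, ?_⟩, ae_all_iff.1 (hopt.ae_eq_optimalShare hu hlam)⟩
    · filter_upwards [hXU] with ω hω using ⟨_, hω⟩
    · filter_upwards [hXU] with ω hω
      rw [← envelopeSlope, ← hω, Function.leftInverse_invFun
        (strictMono_marginalRatio (hu 0) (fun i => hu i.succ) hlam hD).injective]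
  · rintro ⟨hD, ⟨U, hU, hrange, hX0⟩, hshare⟩
    -- A uniform law already forces a.e. measurability, so `U` may be replaced by a measurable
    -- version.
    have hUae : AEMeasurable U P := hU.aemeasurable (by simp) (by simp)
    have hU' : pdf.IsUniform (hUae.mk U) (Ioo 0 1) P volume := by
      rw [pdf.IsUniform, ← Measure.map_congr hUae.ae_eq_mk]
      exact hU
    refine isWelfareOptimal_of_measurable hP hT hu hlam hX hD hUae.measurable_mk hU' ?_
      (ae_all_iff.2 hshare)
    filter_upwards [hrange, hX0, hUae.ae_eq_mk] with ω h1 h2 h3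
    rw [h2, Function.invFun_eq h1, ← h3, envelopeSlope]
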